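/- Let $\alpha\in(0,1)$, $\lambda,\nu>0$, $\kappa,\mu\in\mathbb R$ with $\kappa\nu+\mu\neq 0$, and let $N\ge 1$ be an integer. Write $\hat f(k)=\int_{\mathbb R} f(x)e^{-ikx}\,dx$, let $D^\alpha$ be the Fourier multiplier with symbol $|k|^\alpha$, let $\langle f,g\rangle=\int_{\mathbb R} fg\,dx$, and let $\|u\|_{H^s}^2=\frac1{2\pi}\int_{\mathbb R}(1+k^2)^s|\hat u(k)|^2\,dk$. Let $P$ be the pseudo-product $$\widehat{P(q_1,q_2)}(k)=\int_{\mathbb R} m(k-l,l)\,\hat q_1(k-l)\,\hat q_2(l)\,dl,$$ $$m(k-l,l)=\frac{\lambda k(1+\nu|k-l|^\alpha)(1+\nu|l|^\alpha)}{2(\kappa\nu+\mu)\big[k(1+\nu|l|^\alpha)(|k-l|^\alpha-|k|^\alpha)+l(1+\nu|k|^\alpha)(|l|^\alpha-|k-l|^\alpha)\big]}.$$ For real-valued $u\in H^{N+\alpha/2}(\mathbb R)$ and $1\le n\le N$ put $$E_n(u)=\|\partial_x^n(1+\nu D^\alpha)^{1/2}u\|_{L^2}^2+2\big\langle\partial_x^n(1+\nu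 D^\alpha)^{1/2}u,\ \partial_x^n(1+\nu D^\alpha)^{1/2}P(u,u)\big\rangle,$$ $$E^{(N)}(u)=\sum_{n=1}^N E_n(u)+\|(1+\nu D^\alpha)^{1/2}u\|_{L^2}^2,$$ where the pairing is understood in the principal value sense, because $m(k-l,l)$ is not integrable at $l=0$ and at $l=k$ and $P$ loses derivatives: it is the limit, as $R\to\infty$, of the same expression with $u$ replaced by $u_R$, where $\hat u_R=\mathbf 1_{\{1/R\le|k|\le R\}}\hat u$. Then this limit exists for every real-valued $u\in H^{N+\alpha/2}(\mathbb R)$ and every $1\le n\le N$, and $E^{(N)}(u)\simeq\|u\|^2_{H^{N+\alpha/2}}$ uniformly for small $u$: there are $\epsilon,c,C>0$, depending only on $\alpha,\kappa,\lambda,\mu,\nu,N$, such that every real-valued $u\in H^{N+\alpha/2}(\mathbb R)$ with $\|u\|_{H^{N+\alpha/2}}<\epsilon$ satisfies $$c\,\|u\|^2_{H^{N+\alpha/2}}\le E^{(N)}(u)\le C\,\|u\|^2_{H^{N+\alpha/2}}.$$ -/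

import Mathlib

open MeasureTheory Filter Topology FourierTransform
open scoped SchwartzMap ENNReal

namespace KdVBBM

noncomputable section

/-- Complex-valued square integrable functions on the real line. -/
abbrev L2C : Type := Lp ℂ 2 (volume : Measure ℝ)

/-- Real-valued square integrable functions on the real line. -/
abbrev L2R : Type := Lp ℝ 2 (volume : Measure ℝ)

/-- A real-valued square integrable function, regarded as a complex-valued one. -/
def complexify (u : L2R) : L2C := Complex.ofRealCLM.compLp u

/-- The Fourier transform `k ↦ ∫ f(x) exp(-i k x) dx` of a square integrable function. Mathlib's
transform has the kernel `exp(-2 π i ξ x)`, hence `ξ = k / (2 π)`. -/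
def hat (f : L2C) (k : ℝ) : ℂ := (𝓕 f : L2C) (k / (2 * Real.pi))

/-- The square integrable function whose Fourier transform (in the sense of `hat`) is `g`; it is
`0` when `g` is not square integrable. -/
def invHat (g : ℝ → ℂ) : L2C :=
  open Classical in
  if h : MemLp (fun ξ : ℝ => g (2 * Real.pi * ξ)) 2 (volume : Measure ℝ) then
    𝓕⁻ (h.toLp (fun ξ : ℝ => g (2 * Real.pi * ξ)))
  else 0

/-- The Fourier multiplier with symbol `p`. -/
def multiplier (p : ℝ → ℂ) (f : L2C) : L2C := invHat fun k => p k * hat f k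

/-- The derivative `∂ₓⁿ`, with symbol `(i k)ⁿ`. -/
def dx (n : ℕ) : L2C → L2C := multiplier fun k => (Complex.I * (k : ℂ)) ^ n

/-- The operator `(1 + ν D^α)^{1/2}`, where `D^α` has the symbol `|k|^α`. -/
def sqrtOp (α ν : ℝ) : L2C → L2C :=
  multiplier fun k => ((Real.sqrt (1 + ν * |k| ^ α) : ℝ) : ℂ)

/-- The symbol `m(a, b)` of the normal form transformation, with `a = k - l`, `b = l` and
`k = a + b`. -/
def normalFormSymbol (α κ lam μ ν a b : ℝ) : ℝ :=
  (lam * (a + b) * (1 + ν * |a| ^ α) * (1 + ν * |b| ^ α)) /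
    (2 * (κ * ν + μ) *
      ((a + b) * (1 + ν * |b| ^ α) * (|a| ^ α - |a + b| ^ α)
        + b * (1 + ν * |a + b| ^ α) * (|b| ^ α - |a| ^ α)))

/-- The pseudo-product `P(q₁, q₂)`, whose Fourier transform at `k` is
`∫ m(k - l, l) q̂₁(k - l) q̂₂(l) dl`. -/
def pseudoProduct (α κ lam μ ν : ℝ) (q₁ q₂ : L2C) : L2C :=
  invHat fun k => ∫ l : ℝ,
    (normalFormSymbol α κ lam μ ν (k - l) l : ℂ) * hat q₁ (k - l) * hat q₂ l

/-- The `L²` inner product. For real-valued `f` and `g`, the only ones it is used for, it is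
`∫ f g dx`. -/
def ip (f g : L2C) : ℝ := (inner ℂ f g).re

/-- The part of `f` at the frequencies `1/R ≤ |k| ≤ R`. -/
def bandPart (R : ℝ) : L2C → L2C :=
  multiplier (Set.indicator {k : ℝ | 1 / R ≤ |k| ∧ |k| ≤ R} fun _ => 1)

/-- The pairing `⟨∂ₓⁿ (1 + ν D^α)^{1/2} v, ∂ₓⁿ (1 + ν D^α)^{1/2} P(v, v)⟩`, read literally. All of
its ingredients are honest square integrable functions when `v` has its frequencies in a compact
set that does not contain `0`. -/
def rawPairing (α κ lam μ ν : ℝ) (n : ℕ) (v : L2C) : ℝ :=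
  ip (dx n (sqrtOp α ν v)) (dx n (sqrtOp α ν (pseudoProduct α κ lam μ ν v v)))

/-- The pairing `⟨∂ₓⁿ (1 + ν D^α)^{1/2} u, ∂ₓⁿ (1 + ν D^α)^{1/2} P(u, u)⟩` for a general `u`. The
symbol `m(k - l, l)` is not integrable at `l = 0` and at `k - l = 0`, and `P` loses derivatives,
so that the double integral over the frequencies `(k, l)` that the pairing stands for does not
converge absolutely. It is taken in the principal value sense: the frequencies `k`, `l`, `k - l`
are restricted to `[1/R, R]` in modulus, and `R → ∞`. -/
def pairing (α κ lam μ ν : ℝ) (n : ℕ) (u : L2C) : ℝ :=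
  limUnder atTop fun R : ℝ => rawPairing α κ lam μ ν n (bandPart R u)

/-- The `n`-th partial energy `E_n`. -/
def partialEnergy (α κ lam μ ν : ℝ) (n : ℕ) (u : L2C) : ℝ :=
  ‖dx n (sqrtOp α ν u)‖ ^ 2 + 2 * pairing α κ lam μ ν n u

/-- The modified energy `E^{(N)}`. -/
def modifiedEnergy (α κ lam μ ν : ℝ) (N : ℕ) (u : L2C) : ℝ :=
  (∑ n ∈ Finset.Icc 1 N, partialEnergy α κ lam μ ν n u) + ‖sqrtOp α ν u‖ ^ 2

/-- `u` belongs to the Sobolev space `H^s(ℝ)`. -/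
def MemH (s : ℝ) (u : L2C) : Prop :=
  TemperedDistribution.MemSobolev s 2 (Lp.toTemperedDistribution u : 𝓢'(ℝ, ℂ))

/-- The norm of `H^s(ℝ)`, `‖u‖² = (2π)⁻¹ ∫ (1 + k²)^s |û(k)|² dk`, for `u` in `H^s(ℝ)`. -/
def sobolevNorm (s : ℝ) (u : L2C) : ℝ :=
  Real.sqrt ((2 * Real.pi)⁻¹ * ∫ k : ℝ, (1 + k ^ 2) ^ s * ‖hat u k‖ ^ 2)

end

end KdVBBM

/-!
The energy is a positive quadratic form, equivalent to the square of the `H^{N+α/2}` norm by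
comparing symbols, plus a cubic form. Everything rests on the cubic form being bounded by the cube
of that norm, although its symbol is singular and `P` loses derivatives.

On the Fourier side, write `g(k) = 1 + ν|k|^α`, `h(k) = k / g(k)` and `c = -(a + b)`. The
denominator of `m(a, b)` is, up to the weights `g`, the resonance function
`h(a + b) - h(a) - h(b)`, which is symmetric in `a`, `b`, `c`; and `g(k) m(a, b)` is a constant
multiple of `k / (h(a + b) - h(a) - h(b))` (`weight_mul_normalFormSymbol`). Since `û` is Hermitian
for real-valued `u` (`conj_hat_complexify`), the pairing of a band-limited `u` is the integral of
`(a + b)^{2n+1} / (h(a + b) - h(a) - h(b)) * û(a) û(b) û(c)`. The factors other than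
the numerator are invariant under the rotation `(a, b) ↦ (b, c)`, which preserves the measure and
has order three, so the numerator may be averaged to `((a + b)^{2n+1} - a^{2n+1} - b^{2n+1}) / 3`
(`three_mul_integral_pairingIntegrand`, `rawPairing_eq`).

The symmetrized symbol is harmless. If `x` is the smallest of the three frequencies and `M` the
largest, the numerator is `O(|x| M^{2n})`, and by concavity of `h` on each half-line the resonance
function is at least a multiple of `|x| M^α / (g(x) g(M))` (`resonance_lower`). The quotient is
therefore `O(g(x) (1 + M²)^n)` (`abs_symSymbol_le`): `n` derivatives fall on each of the two
factors with the largest frequencies, which are comparable and are estimated in `L²`, and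
`g(x) û(x)` is estimated in `L¹` by the Cauchy–Schwarz inequality, which needs only
`N + α/2 > α + 1/2` (`integrable_symSymbol_mul_tripleProduct`). So the symmetrized integral
converges absolutely, the principal value exists by dominated convergence (`tendsto_rawPairing`),
and the cubic part is absorbed by the quadratic part when `u` is small.
-/

namespace KdVBBM

noncomputable section

/-! ### The Fourier transform in the frequency variable `k = 2πξ` -/

lemma stronglyMeasurable_hat (f : L2C) : StronglyMeasurable (hat f) :=
  (Lp.stronglyMeasurable (𝓕 f : L2C)).comp_measurable (measurable_id.div_const _)

lemma ae_comp_const_mul {P : ℝ → Prop} {c : ℝ} (hc : c ≠ 0) (h : ∀ᵐ ξ, P ξ) :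
    ∀ᵐ k : ℝ, P (c * k) := by
  have hq : Measure.QuasiMeasurePreserving (fun x : ℝ => c * x) volume volume := by
    refine ⟨measurable_const_mul c, ?_⟩
    rw [Real.map_volume_mul_left hc]
    exact Measure.smul_absolutelyContinuous
  exact hq.ae h

lemma ae_comp_div_const {P : ℝ → Prop} {c : ℝ} (hc : c ≠ 0) (h : ∀ᵐ ξ, P ξ) :
    ∀ᵐ k : ℝ, P (k / c) := by
  filter_upwards [ae_comp_const_mul (inv_ne_zero hc) h] with k hk
  rwa [div_eq_inv_mul]

lemma MemLp.comp_const_mul {g : ℝ → ℂ} {c : ℝ} (hc : c ≠ 0)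
    (h : MemLp g 2 (volume : Measure ℝ)) :
    MemLp (fun ξ => g (c * ξ)) 2 (volume : Measure ℝ) := by
  have he : MeasurableEmbedding (fun x : ℝ => c * x) :=
    (Homeomorph.mulLeft₀ c hc).measurableEmbedding
  have := he.memLp_map_measure_iff (g := g) (μ := volume) (p := 2)
  rw [Real.map_volume_mul_left hc] at this
  exact this.1 (h.smul_measure ENNReal.ofReal_ne_top)

lemma memLp_hat (f : L2C) : MemLp (hat f) 2 volume := by
  have h : MemLp (fun ξ => (𝓕 f : L2C) ((2 * Real.pi)⁻¹ * ξ)) 2 volume :=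
    MemLp.comp_const_mul (by positivity) (Lp.memLp (𝓕 f : L2C))
  refine h.ae_eq (Eventually.of_forall fun k => ?_)
  simp only [hat, div_eq_inv_mul]

lemma hat_invHat {g : ℝ → ℂ} (h : MemLp g 2 volume) : hat (invHat g) =ᵐ[volume] g := by
  have h' : MemLp (fun ξ : ℝ => g (2 * Real.pi * ξ)) 2 (volume : Measure ℝ) :=
    MemLp.comp_const_mul (by positivity) h
  have h2 : (𝓕 (invHat g) : L2C) =ᵐ[volume] fun ξ : ℝ => g (2 * Real.pi * ξ) := by
    rw [invHat, dif_pos h', FourierTransform.fourier_fourierInv_eq]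
    exact h'.coeFn_toLp
  have h3 := ae_comp_div_const (c := 2 * Real.pi) (by positivity) h2
  filter_upwards [h3] with k hk
  rw [hat, hk]
  congr 1
  field_simp

lemma hat_multiplier {p : ℝ → ℂ} {f : L2C} (h : MemLp (fun k => p k * hat f k) 2 volume) :
    hat (multiplier p f) =ᵐ[volume] fun k => p k * hat f k := hat_invHat h

/-- Plancherel's theorem. -/
lemma inner_eq_integral_hat (f g : L2C) :
    inner ℂ f g = ((2 * Real.pi)⁻¹ : ℝ) • ∫ k, starRingEnd ℂ (hat f k) * hat g k := by
  rw [← Lp.inner_fourier_eq, L2.inner_def]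
  have h := Measure.integral_comp_div
    (fun ξ => starRingEnd ℂ ((𝓕 f : L2C) ξ) * (𝓕 g : L2C) ξ) (2 * Real.pi)
  simp only [hat]
  rw [h, smul_smul, abs_of_pos (by positivity), inv_mul_cancel₀ (by positivity), one_smul]
  refine integral_congr_ae (Eventually.of_forall fun ξ => ?_)
  simp [mul_comm]

lemma norm_sq_eq_integral_hat (f : L2C) :
    ‖f‖ ^ 2 = (2 * Real.pi)⁻¹ * ∫ k, ‖hat f k‖ ^ 2 := by
  have h := inner_eq_integral_hat f f
  rw [inner_self_eq_norm_sq_to_K] at h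
  have h2 : ∀ k, starRingEnd ℂ (hat f k) * hat f k = ((‖hat f k‖ ^ 2 : ℝ) : ℂ) := by
    intro k
    rw [Complex.conj_mul']
    norm_cast
  simp only [h2] at h
  rw [integral_complex_ofReal] at h
  simp only [Complex.real_smul] at h
  refine Complex.ofReal_injective ?_
  rw [Complex.ofReal_mul, Complex.ofReal_pow]
  exact h

/-- The Fourier transform of the complex conjugate of `f` is `k ↦ conj (f̂ (-k))`. On Schwartz
functions this is a computation, and both sides are continuous on `L²`. -/
lemma fourier_conj_compLp (f : L2C) :
    (𝓕 ((Complex.conjCLE : ℂ →L[ℝ] ℂ).compLpL 2 volume f) : L2C) =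
      (Complex.conjCLE : ℂ →L[ℝ] ℂ).compLpL 2 volume
        (Lp.compMeasurePreserving (fun x : ℝ => -x) (Measure.measurePreserving_neg volume)
          (𝓕 f : L2C)) := by
  refine DenseRange.induction_on (p := fun f : L2C =>
    (𝓕 ((Complex.conjCLE : ℂ →L[ℝ] ℂ).compLpL 2 volume f) : L2C) =
      (Complex.conjCLE : ℂ →L[ℝ] ℂ).compLpL 2 volume
        (Lp.compMeasurePreserving (fun x : ℝ => -x) (Measure.measurePreserving_neg volume)
          (𝓕 f : L2C)))
    (SchwartzMap.denseRange_toLpCLM (E := ℝ) (F := ℂ) (p := 2) (μ := volume)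
      ENNReal.ofNat_ne_top) f ?_ ?_
  · have h1 : Continuous fun f : L2C => (𝓕 f : L2C) := (Lp.fourierTransformₗᵢ ℝ ℂ).continuous
    have h2 : Continuous (Lp.compMeasurePreserving (E := ℂ) (p := 2) (fun x : ℝ => -x)
        (Measure.measurePreserving_neg volume)) :=
      (Lp.isometry_compMeasurePreserving _).continuous
    exact isClosed_eq (h1.comp (ContinuousLinearMap.continuous _))
      ((ContinuousLinearMap.continuous _).comp (h2.comp h1))
  · intro φ
    have h0 : (Complex.conjCLE : ℂ →L[ℝ] ℂ).compLpL 2 volume (SchwartzMap.toLpCLM ℝ ℂ 2 volume φ)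
        = (φ.postcompCLM (Complex.conjCLE : ℂ →L[ℝ] ℂ)).toLp 2 volume := by
      apply Lp.ext
      filter_upwards [ContinuousLinearMap.coeFn_compLp (Complex.conjCLE : ℂ →L[ℝ] ℂ)
        (SchwartzMap.toLpCLM ℝ ℂ 2 volume φ), SchwartzMap.coeFn_toLp φ 2 volume,
        SchwartzMap.coeFn_toLp (φ.postcompCLM (Complex.conjCLE : ℂ →L[ℝ] ℂ)) 2 volume]
        with x h1 h2 h3
      rw [h3]
      refine h1.trans ?_
      rw [SchwartzMap.toLpCLM_apply, h2]
      rfl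
    rw [h0, SchwartzMap.toLpCLM_apply, SchwartzMap.toLp_fourier_eq, SchwartzMap.toLp_fourier_eq]
    apply Lp.ext
    have hneg : ∀ᵐ x : ℝ, ((𝓕 φ : 𝓢(ℝ, ℂ)).toLp 2 volume : L2C) (-x) = (𝓕 φ : 𝓢(ℝ, ℂ)) (-x) :=
      (Measure.measurePreserving_neg (volume : Measure ℝ)).quasiMeasurePreserving.ae
        (SchwartzMap.coeFn_toLp (𝓕 φ : 𝓢(ℝ, ℂ)) 2 volume)
    filter_upwards [SchwartzMap.coeFn_toLp
        (𝓕 (φ.postcompCLM (Complex.conjCLE : ℂ →L[ℝ] ℂ)) : 𝓢(ℝ, ℂ)) 2 volume,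
      ContinuousLinearMap.coeFn_compLp (Complex.conjCLE : ℂ →L[ℝ] ℂ)
        (Lp.compMeasurePreserving (fun x : ℝ => -x) (Measure.measurePreserving_neg volume)
          ((𝓕 φ : 𝓢(ℝ, ℂ)).toLp 2 volume)),
      Lp.coeFn_compMeasurePreserving ((𝓕 φ : 𝓢(ℝ, ℂ)).toLp 2 volume)
        (Measure.measurePreserving_neg (volume : Measure ℝ)), hneg] with x h1 h2 h3 h4
    rw [h1]
    refine Eq.trans ?_ h2.symm
    rw [h3, Function.comp_apply, h4, SchwartzMap.fourier_coe, SchwartzMap.fourier_coe,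
      Real.fourier_eq', Real.fourier_eq']
    change _ = starRingEnd ℂ _
    rw [← integral_conj]
    refine integral_congr_ae (Eventually.of_forall fun v => ?_)
    simp [← Complex.exp_conj, Complex.conj_ofNat]

/-- The Fourier transform of a real-valued function is Hermitian. -/
lemma conj_hat_complexify (u : L2R) :
    ∀ᵐ k, starRingEnd ℂ (hat (complexify u) k) = hat (complexify u) (-k) := by
  have h0 : (Complex.conjCLE : ℂ →L[ℝ] ℂ).compLpL 2 volume (complexify u) = complexify u := by
    apply Lp.ext
    filter_upwards [ContinuousLinearMap.coeFn_compLp (Complex.conjCLE : ℂ →L[ℝ] ℂ) (complexify u),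
      ContinuousLinearMap.coeFn_compLp Complex.ofRealCLM u] with x h1 h2
    refine h1.trans ?_
    rw [complexify, h2]
    simp
  have h := fourier_conj_compLp (complexify u)
  rw [h0] at h
  have h2 := ContinuousLinearMap.coeFn_compLp (Complex.conjCLE : ℂ →L[ℝ] ℂ)
    (Lp.compMeasurePreserving (fun x : ℝ => -x) (Measure.measurePreserving_neg volume)
          (𝓕 (complexify u) : L2C))
  have h3 := Lp.coeFn_compMeasurePreserving (𝓕 (complexify u) : L2C)
        (Measure.measurePreserving_neg (volume : Measure ℝ))
  have h4 : ∀ᵐ x : ℝ, (𝓕 (complexify u) : L2C) x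
      = starRingEnd ℂ ((𝓕 (complexify u) : L2C) (-x)) := by
    filter_upwards [h2, h3] with x h2 h3
    conv_lhs => rw [h]
    refine h2.trans ?_
    rw [h3]
    rfl
  filter_upwards [ae_comp_div_const (c := 2 * Real.pi) (by positivity) h4] with k hk
  simp only [hat]
  rw [hk, neg_div, Complex.conj_conj]

/-- A function in `H^s` has a Fourier transform with `(1 + ξ²)^{s/2} û(ξ)` square integrable. -/
lemma MemH.memLp_fourier {s : ℝ} (hs : 0 ≤ s) {u : L2C} (hu : MemH s u) :
    MemLp (fun ξ : ℝ => (((1 + ‖ξ‖ ^ 2) ^ (s / 2) : ℝ) : ℂ) * (𝓕 u : L2C) ξ) 2 volume := by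
  obtain ⟨f, hf⟩ := TemperedDistribution.memSobolev_iff_exists_smulLeftCLM_fourier.1 hu
  rw [Lp.fourier_toTemperedDistribution_eq] at hf
  -- Dividing by the weight is a bounded operation on `L²`, and a function in `L²` is determined by
  -- the tempered distribution it defines.
  set q : ℝ → ℂ := fun ξ => (((1 + ‖ξ‖ ^ 2) ^ (-s / 2) : ℝ) : ℂ) with hq
  have hqt : q.HasTemperateGrowth := by fun_prop
  have hqb : MemLp q ∞ (volume : Measure ℝ) := by
    refine memLp_top_of_bound hqt.1.continuous.aestronglyMeasurable 1
      (Eventually.of_forall fun ξ => ?_)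
    rw [Complex.norm_real, Real.norm_eq_abs, abs_of_nonneg (by positivity)]
    exact Real.rpow_le_one_of_one_le_of_nonpos (by nlinarith [norm_nonneg ξ]) (by linarith)
  have h1 := Lp.toTemperedDistribution_smul_eq (q := 2) (r := 2) hqt hqb f
  rw [← hf, TemperedDistribution.smulLeftCLM_smulLeftCLM_apply (by fun_prop) hqt] at h1
  have h2 : (q * fun ξ : ℝ => (((1 + ‖ξ‖ ^ 2) ^ (s / 2) : ℝ) : ℂ)) = fun _ => 1 := by
    ext ξ
    simp only [hq, Pi.mul_apply]
    rw [← Complex.ofReal_mul, ← Real.rpow_add (by positivity)]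
    ring_nf
    simp
  rw [mul_comm, h2, TemperedDistribution.smulLeftCLM_const, one_smul] at h1
  have h3 : hqb.toLp q • f = (𝓕 u : L2C) := by
    have hk := Lp.ker_toTemperedDistributionCLM_eq_bot (E := ℝ) (F := ℂ) (μ := volume) (p := 2)
    exact LinearMap.ker_eq_bot.1 hk h1
  refine (Lp.memLp f).ae_eq ?_
  filter_upwards [Lp.coeFn_lpSMul (r := 2) (hqb.toLp q) f, hqb.coeFn_toLp] with ξ h4 h5
  rw [← h3, h4, Pi.smul_apply', h5, smul_eq_mul, ← mul_assoc]
  have := congrFun h2 ξ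
  simp only [Pi.mul_apply] at this
  rw [mul_comm _ (q ξ), this, one_mul]

lemma MemH.integrable {s : ℝ} (hs : 0 ≤ s) {u : L2C} (hu : MemH s u) :
    Integrable fun k : ℝ => (1 + k ^ 2) ^ s * ‖hat u k‖ ^ 2 := by
  have h1 := MemLp.comp_const_mul (c := (2 * Real.pi)⁻¹) (by positivity) (hu.memLp_fourier hs)
  have h2 := (memLp_two_iff_integrable_sq_norm h1.1).1 h1
  refine (h2.const_mul (((2 * Real.pi) ^ 2) ^ s)).mono' ?_ (Eventually.of_forall fun k => ?_)
  · exact ((by fun_prop : Measurable fun k : ℝ => (1 + k ^ 2) ^ s).aestronglyMeasurable).mul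
      ((stronglyMeasurable_hat u).norm.pow 2).aestronglyMeasurable
  · rw [Real.norm_eq_abs, abs_of_nonneg (by positivity), norm_mul, Complex.norm_real,
      mul_pow ‖_‖, Real.norm_eq_abs, abs_of_nonneg (by positivity), ← mul_assoc, hat, div_eq_inv_mul]
    gcongr
    rw [← Real.rpow_mul_natCast (by positivity), Nat.cast_ofNat, div_mul_cancel₀ _ two_ne_zero,
      ← Real.mul_rpow (by positivity) (by positivity)]
    gcongr
    have h3 : (2 * Real.pi) ^ 2 * ((2 * Real.pi)⁻¹ * k) ^ 2 = k ^ 2 := by field_simp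
    rw [mul_add, Real.norm_eq_abs, sq_abs, h3]
    nlinarith [Real.pi_gt_three]

lemma sobolevNorm_sq {s : ℝ} (u : L2C) :
    sobolevNorm s u ^ 2 = (2 * Real.pi)⁻¹ * ∫ k : ℝ, (1 + k ^ 2) ^ s * ‖hat u k‖ ^ 2 :=
  Real.sq_sqrt (mul_nonneg (by positivity) (integral_nonneg fun k => by positivity))

/-! ### The resonance function and the symmetrized symbol -/

/-- The symbol `1 + ν|k|^α` of `1 + νD^α`. -/
def weight (α ν k : ℝ) : ℝ := 1 + ν * |k| ^ α

/-- The odd function `k / (1 + ν|k|^α)`, whose defect of additivity is, up to weights, the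
denominator of `normalFormSymbol`. -/
def dispersion (α ν k : ℝ) : ℝ := k / weight α ν k

/-- The resonance function of the frequencies `a`, `b` and `a + b`. -/
def resonance (α ν a b : ℝ) : ℝ :=
  dispersion α ν (a + b) - dispersion α ν a - dispersion α ν b

/-- The symbol `((a+b)^m - a^m - b^m) / resonance`. It is symmetric in the three frequencies
`a`, `b` and `-a-b` when `m` is odd. -/
def symSymbol (α ν : ℝ) (m : ℕ) (a b : ℝ) : ℝ :=
  ((a + b) ^ m - a ^ m - b ^ m) / resonance α ν a b

section basic

variable {α ν : ℝ}

lemma one_le_weight (hν : 0 < ν) (k : ℝ) : 1 ≤ weight α ν k :=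
  le_add_of_nonneg_right (by positivity)

lemma weight_pos (hν : 0 < ν) (k : ℝ) : 0 < weight α ν k :=
  one_pos.trans_le (one_le_weight hν k)

lemma weight_neg (k : ℝ) : weight α ν (-k) = weight α ν k := by simp [weight]

lemma weight_le_weight (hα : 0 < α) (hν : 0 < ν) {a b : ℝ} (h : |a| ≤ |b|) :
    weight α ν a ≤ weight α ν b := by
  unfold weight
  gcongr

lemma measurable_weight : Measurable (weight α ν) := by
  unfold weight
  fun_prop

lemma measurable_dispersion : Measurable (dispersion α ν) :=
  measurable_id.div measurable_weight

lemma measurable_resonance : Measurable fun p : ℝ × ℝ => resonance α ν p.1 p.2 := by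
  have h := measurable_dispersion (α := α) (ν := ν)
  unfold resonance
  fun_prop

lemma measurable_symSymbol (m : ℕ) : Measurable fun p : ℝ × ℝ => symSymbol α ν m p.1 p.2 := by
  have h := measurable_resonance (α := α) (ν := ν)
  unfold symSymbol
  fun_prop

lemma dispersion_neg (k : ℝ) : dispersion α ν (-k) = -dispersion α ν k := by
  rw [dispersion, weight_neg, neg_div, dispersion]

lemma resonance_swap (a b : ℝ) : resonance α ν b a = resonance α ν a b := by
  unfold resonance
  rw [add_comm b a]
  ring

lemma resonance_rotate (a b : ℝ) : resonance α ν b (-a - b) = resonance α ν a b := by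
  have h1 : b + (-a - b) = -a := by ring
  have h2 : -a - b = -(a + b) := by ring
  rw [resonance, h1, h2, dispersion_neg, dispersion_neg, resonance]
  ring

lemma resonance_neg (a b : ℝ) : resonance α ν (-a) (-b) = -resonance α ν a b := by
  have h : -a + -b = -(a + b) := by ring
  rw [resonance, h, dispersion_neg, dispersion_neg, dispersion_neg, resonance]
  ring

lemma symSymbol_swap (m : ℕ) (a b : ℝ) : symSymbol α ν m b a = symSymbol α ν m a b := by
  rw [symSymbol, resonance_swap, symSymbol, add_comm b a]
  ring

lemma symSymbol_rotate {m : ℕ} (hm : Odd m) (a b : ℝ) :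
    symSymbol α ν m b (-a - b) = symSymbol α ν m a b := by
  have h1 : b + (-a - b) = -a := by ring
  have h2 : -a - b = -(a + b) := by ring
  rw [symSymbol, resonance_rotate, symSymbol, h1, h2, hm.neg_pow, hm.neg_pow]
  ring

/-- The resonance function is the denominator of `normalFormSymbol`, up to weights. Where the
resonance function vanishes, both sides are `0`. -/
lemma weight_mul_normalFormSymbol (hν : 0 < ν) (κ lam μ a b : ℝ) :
    weight α ν (a + b) * normalFormSymbol α κ lam μ ν a b =
      lam * ν / (2 * (κ * ν + μ)) * ((a + b) / resonance α ν a b) := by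
  have ha := (weight_pos (α := α) hν a).ne'
  have hb := (weight_pos (α := α) hν b).ne'
  have hk := (weight_pos (α := α) hν (a + b)).ne'
  have hden : (a + b) * (1 + ν * |b| ^ α) * (|a| ^ α - |a + b| ^ α)
        + b * (1 + ν * |a + b| ^ α) * (|b| ^ α - |a| ^ α) =
      weight α ν a * weight α ν b * weight α ν (a + b) / ν * resonance α ν a b := by
    simp only [resonance, dispersion]
    field_simp
    unfold weight
    ring
  rw [normalFormSymbol, hden]
  change weight α ν (a + b) * (lam * (a + b) * weight α ν a * weight α ν b / _) = _
  by_cases hr : resonance α ν a b = 0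
  · simp [hr]
  by_cases hκ : κ * ν + μ = 0
  · simp [hκ]
  field_simp

/-- A property of pairs `(a, b)` that is symmetric in the three frequencies `a`, `b`, `-a-b` may be
checked for `|a| ≤ |b| ≤ |a + b|`. -/
lemma frequency_induction {P : ℝ → ℝ → Prop} (swap : ∀ a b, P a b → P b a)
    (rotate : ∀ a b, P a b → P b (-a - b))
    (ordered : ∀ a b, |a| ≤ |b| → |b| ≤ |a + b| → P a b) (a b : ℝ) : P a b := by
  have rotate' : ∀ a b, P b (-a - b) → P a b := fun a b h => by
    have := rotate _ _ (rotate _ _ h)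
    have h1 : -b - (-a - b) = a := by ring
    have h2 : -(-a - b) - (-b - (-a - b)) = b := by ring
    rwa [h2, h1] at this
  have hc : |(-a - b)| = |a + b| := by rw [← abs_neg]; congr 1; ring
  have e2 : |b + (-a - b)| = |a| := by rw [← abs_neg a]; congr 1; ring
  have e4 : |(-a - b) + b| = |a| := by rw [add_comm, e2]
  have e5 : |b + a| = |a + b| := by rw [add_comm]
  have e6 : |(-b - a)| = |a + b| := by rw [← abs_neg]; congr 1; ring
  have e7 : |a + (-b - a)| = |b| := by rw [← abs_neg b]; congr 1; ring
  rcases le_total |a| |b| with h1 | h1 <;> rcases le_total |b| |a + b| with h2 | h2 <;>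
    rcases le_total |a| |a + b| with h3 | h3
  · exact ordered a b h1 h2
  · exact ordered a b h1 h2
  · refine swap _ _ (rotate' _ _ (ordered _ _ ?_ ?_))
    · rwa [e6]
    · rwa [e6, e7]
  · refine swap _ _ (rotate' _ _ (swap _ _ (ordered _ _ ?_ ?_)))
    · rwa [e6]
    · rwa [add_comm, e7]
  · exact swap _ _ (ordered b a h1 (by rwa [e5]))
  · refine rotate' _ _ (ordered _ _ ?_ ?_)
    · rwa [hc]
    · rwa [hc, e2]
  · exact swap _ _ (ordered b a h1 (by rwa [e5]))
  · refine rotate' _ _ (swap _ _ (ordered _ _ ?_ ?_))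
    · rwa [hc]
    · rwa [e4]

/-- When `|a| ≤ |b| ≤ |a + b|`, the frequencies `a` and `b` have the same sign. -/
lemma same_sign {a b : ℝ} (h1 : |a| ≤ |b|) (h2 : |b| ≤ |a + b|) :
    (0 ≤ a ∧ 0 ≤ b) ∨ (0 ≤ -a ∧ 0 ≤ -b) ∨ a = 0 := by
  rcases le_total 0 a with ha | ha <;> rcases le_total 0 b with hb | hb
  · exact Or.inl ⟨ha, hb⟩
  · rw [abs_of_nonneg ha, abs_of_nonpos hb] at h1
    rw [abs_of_nonpos hb, abs_of_nonpos (by linarith)] at h2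
    exact Or.inr (Or.inr (by linarith))
  · rw [abs_of_nonpos ha, abs_of_nonneg hb] at h1
    rw [abs_of_nonneg hb, abs_of_nonneg (by linarith)] at h2
    exact Or.inr (Or.inr (by linarith))
  · exact Or.inr (Or.inl ⟨by linarith, by linarith⟩)

end basic

section bounds

variable {α ν : ℝ}

lemma half_rpow_lt_one (hα : 0 < α) : (1 / 2 : ℝ) ^ α < 1 :=
  Real.rpow_lt_one (by norm_num) (by norm_num) hα

lemma resonance_lower_of_nonneg (hα : 0 < α) (hν : 0 < ν) {x y : ℝ} (hx : 0 ≤ x) (hxy : x ≤ y) :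
    ν * (1 - (1 / 2) ^ α) * x * (x + y) ^ α ≤
      -resonance α ν x y * (weight α ν x * weight α ν (x + y)) := by
  have hy : 0 ≤ y := hx.trans hxy
  have px := weight_pos (α := α) hν x
  have py := weight_pos (α := α) hν y
  have pM := weight_pos (α := α) hν (x + y)
  have hyM : weight α ν y ≤ weight α ν (x + y) := weight_le_weight hα hν (by
    rw [abs_of_nonneg hy, abs_of_nonneg (by positivity)]; linarith)
  -- The smaller of the two summands is at most half of the sum.
  have h1 : x ^ α ≤ (1 / 2) ^ α * (x + y) ^ α := by
    rw [← Real.mul_rpow (by norm_num) (by positivity)]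
    exact Real.rpow_le_rpow hx (by linarith) hα.le
  have h2 : ν * (1 - (1 / 2) ^ α) * (x + y) ^ α ≤ weight α ν (x + y) - weight α ν x := by
    rw [weight, weight, abs_of_nonneg hx, abs_of_nonneg (by positivity : 0 ≤ x + y)]
    nlinarith
  have h3 : -resonance α ν x y * (weight α ν x * weight α ν (x + y)) =
      x * (weight α ν (x + y) - weight α ν x)
        + y * (weight α ν (x + y) - weight α ν y) * (weight α ν x / weight α ν y) := by
    rw [resonance, dispersion, dispersion, dispersion]
    field_simp
    ring
  have h4 : 0 ≤ y * (weight α ν (x + y) - weight α ν y) * (weight α ν x / weight α ν y) :=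
    mul_nonneg (mul_nonneg hy (by linarith)) (by positivity)
  rw [h3]
  nlinarith [mul_le_mul_of_nonneg_left h2 hx]

/-- The lower bound for the resonance function, in terms of the smallest frequency `a` and the
largest one, `a + b`. It comes from the strict concavity of the dispersion relation on each
half-line. -/
lemma resonance_lower (hα : 0 < α) (hν : 0 < ν) {a b : ℝ} (h1 : |a| ≤ |b|)
    (h2 : |b| ≤ |a + b|) :
    ν * (1 - (1 / 2) ^ α) * |a| * |a + b| ^ α ≤
      |resonance α ν a b| * (weight α ν a * weight α ν (a + b)) := by
  have hw : 0 ≤ weight α ν a * weight α ν (a + b) :=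
    mul_nonneg (weight_pos hν _).le (weight_pos hν _).le
  rcases same_sign h1 h2 with ⟨ha, hb⟩ | ⟨ha, hb⟩ | rfl
  · have h := resonance_lower_of_nonneg hα hν ha
      (by rwa [abs_of_nonneg ha, abs_of_nonneg hb] at h1 : a ≤ b)
    rw [abs_of_nonneg ha, abs_of_nonneg (by positivity : 0 ≤ a + b)]
    exact h.trans (mul_le_mul_of_nonneg_right (neg_le_abs _) hw)
  · have h := resonance_lower_of_nonneg hα hν ha
      (by rwa [← abs_neg, ← abs_neg b, abs_of_nonneg ha, abs_of_nonneg hb] at h1 : -a ≤ -b)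
    have e : -a + -b = -(a + b) := by ring
    rw [resonance_neg, e, weight_neg, weight_neg, neg_neg] at h
    rw [← abs_neg, ← abs_neg (a + b), abs_of_nonneg ha, abs_of_nonneg (by linarith : 0 ≤ -(a + b))]
    exact h.trans (mul_le_mul_of_nonneg_right (le_abs_self _) hw)
  · simp only [abs_zero, mul_zero, zero_mul]
    exact mul_nonneg (abs_nonneg _) hw

lemma pow_add_sub_le {x y : ℝ} (hx : 0 ≤ x) (hy : 0 ≤ y) (j : ℕ) :
    (x + y) ^ (j + 1) - y ^ (j + 1) ≤ (j + 1) * x * (x + y) ^ j := by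
  induction j with
  | zero => simp
  | succ j ih =>
    have h1 : y ^ (j + 1) ≤ (x + y) ^ (j + 1) := by gcongr; linarith
    have h2 := mul_le_mul_of_nonneg_left ih (by positivity : 0 ≤ x + y)
    have h3 := mul_le_mul_of_nonneg_left h1 hx
    push_cast
    have e1 : (x + y) ^ (j + 1 + 1) - y ^ (j + 1 + 1)
      = (x + y) * ((x + y) ^ (j + 1) - y ^ (j + 1)) + x * y ^ (j + 1) := by ring
    have e2 : ((j : ℝ) + 1 + 1) * x * (x + y) ^ (j + 1)
      = (x + y) * ((j + 1) * x * (x + y) ^ j) + x * (x + y) ^ (j + 1) := by ring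
    rw [e1, e2]
    linarith

lemma abs_pow_sub_pow_sub_pow_le_of_nonneg {x y : ℝ} (hx : 0 ≤ x) (hy : 0 ≤ y) (j : ℕ) :
    |(x + y) ^ (j + 1) - x ^ (j + 1) - y ^ (j + 1)| ≤ (j + 1) * x * (x + y) ^ j := by
  have h1 : x ^ j ≤ (x + y) ^ j := by gcongr; linarith
  have h2 : y ^ j ≤ (x + y) ^ j := by gcongr; linarith
  have h3 : 0 ≤ (x + y) ^ (j + 1) - x ^ (j + 1) - y ^ (j + 1) := by
    have e : (x + y) ^ (j + 1) - x ^ (j + 1) - y ^ (j + 1)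
      = x * ((x + y) ^ j - x ^ j) + y * ((x + y) ^ j - y ^ j) := by ring
    rw [e]
    exact add_nonneg (mul_nonneg hx (by linarith)) (mul_nonneg hy (by linarith))
  rw [abs_of_nonneg h3]
  have := pow_add_sub_le hx hy j
  have : 0 ≤ x ^ (j + 1) := by positivity
  linarith

lemma abs_pow_sub_pow_sub_pow_le {a b : ℝ} (h1 : |a| ≤ |b|) (h2 : |b| ≤ |a + b|) (n : ℕ) :
    |(a + b) ^ (2 * n + 1) - a ^ (2 * n + 1) - b ^ (2 * n + 1)| ≤
      (2 * n + 1) * |a| * |a + b| ^ (2 * n) := by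
  have ho : Odd (2 * n + 1) := ⟨n, rfl⟩
  rcases same_sign h1 h2 with ⟨ha, hb⟩ | ⟨ha, hb⟩ | rfl
  · have h := abs_pow_sub_pow_sub_pow_le_of_nonneg ha hb (2 * n)
    rw [abs_of_nonneg ha, abs_of_nonneg (by positivity : 0 ≤ a + b)]
    exact_mod_cast h
  · have h := abs_pow_sub_pow_sub_pow_le_of_nonneg ha hb (2 * n)
    have e : -a + -b = -(a + b) := by ring
    have e' : -(a + b) ^ (2 * n + 1) - -a ^ (2 * n + 1) - -b ^ (2 * n + 1)
      = -((a + b) ^ (2 * n + 1) - a ^ (2 * n + 1) - b ^ (2 * n + 1)) := by ring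
    rw [e, ho.neg_pow, ho.neg_pow, ho.neg_pow, e', abs_neg] at h
    rw [← abs_neg a, ← abs_neg (a + b), abs_of_nonneg ha,
      abs_of_nonneg (by linarith : 0 ≤ -(a + b))]
    exact_mod_cast h
  · simp

/-- The constant in the bound for the symmetrized symbol. -/
def symConst (α ν : ℝ) (n : ℕ) : ℝ := (2 * n + 1) * (1 + ν) / (ν * (1 - (1 / 2) ^ α))

lemma symConst_pos (hα : 0 < α) (hν : 0 < ν) (n : ℕ) : 0 < symConst α ν n := by
  have := sub_pos.2 (half_rpow_lt_one hα)
  unfold symConst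
  positivity

lemma pow_mul_weight_le (hα : 0 < α) (hα1 : α < 1) (hν : 0 < ν) {n : ℕ} (hn : 1 ≤ n) {M : ℝ} (hM : 0 < M) :
    M ^ (2 * n) * weight α ν M ≤ (1 + ν) * (1 + M ^ 2) ^ n * M ^ α := by
  have hMα : 0 < M ^ α := by positivity
  have h1 : M ^ (2 * n) ≤ (1 + M ^ 2) ^ n := by
    rw [pow_mul]
    gcongr
    linarith
  have h2 : M ^ (2 * n) ≤ (1 + M ^ 2) ^ n * M ^ α := by
    -- For `M ≤ 1` this is where `α < 2n` is used.
    rcases le_total M 1 with h | h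
    · have h3 : M ^ (2 * n) ≤ M ^ α := by
        rw [← Real.rpow_natCast]
        refine Real.rpow_le_rpow_of_exponent_ge hM h ?_
        have : (1 : ℝ) ≤ n := by exact_mod_cast hn
        push_cast
        linarith
      have h4 : (1 : ℝ) ≤ (1 + M ^ 2) ^ n := one_le_pow₀ (by nlinarith)
      nlinarith
    · have h3 : 1 ≤ M ^ α := Real.one_le_rpow h hα.le
      have h4 : (0 : ℝ) ≤ (1 + M ^ 2) ^ n := by positivity
      nlinarith
  rw [weight, abs_of_pos hM]
  nlinarith [mul_le_mul_of_nonneg_right h1 (mul_nonneg hν.le hMα.le)]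

/-- The symmetrized symbol loses only `n` derivatives on each of the two largest frequencies: its
numerator vanishes to first order in the smallest frequency, just as the resonance function does. -/
lemma abs_symSymbol_le (hα : 0 < α) (hα1 : α < 1) (hν : 0 < ν) {n : ℕ} (hn : 1 ≤ n) {a b : ℝ}
    (h1 : |a| ≤ |b|) (h2 : |b| ≤ |a + b|) :
    |symSymbol α ν (2 * n + 1) a b| ≤ symConst α ν n * weight α ν a * (1 + (a + b) ^ 2) ^ n := by
  have hc := sub_pos.2 (half_rpow_lt_one hα)
  have hK := symConst_pos hα hν n
  have hwa := weight_pos (α := α) hν a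
  have hwM := weight_pos (α := α) hν (a + b)
  rcases eq_or_ne a 0 with rfl | ha
  · simp only [symSymbol, zero_add, ne_eq, Nat.add_eq_zero_iff, one_ne_zero, and_false,
      not_false_eq_true, zero_pow, sub_zero, sub_self, zero_div, abs_zero]
    positivity
  have ha' : 0 < |a| := abs_pos.2 ha
  have hM : 0 < |a + b| := ha'.trans_le (h1.trans h2)
  have hMα : 0 < |a + b| ^ α := by positivity
  have hlow := resonance_lower hα hν h1 h2
  have hres : 0 < |resonance α ν a b| := abs_pos.2 fun h => by
    rw [h, abs_zero, zero_mul] at hlow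
    exact absurd hlow (not_le.2 (by positivity))
  have hnum := abs_pow_sub_pow_sub_pow_le h1 h2 n
  have hpw := pow_mul_weight_le hα hα1 hν hn hM
  rw [sq_abs, show weight α ν |a + b| = weight α ν (a + b) by simp [weight]] at hpw
  rw [symSymbol, abs_div, div_le_iff₀ hres]
  refine hnum.trans ?_
  rw [← mul_le_mul_iff_of_pos_right hwM]
  calc (2 * (n : ℝ) + 1) * |a| * |a + b| ^ (2 * n) * weight α ν (a + b)
      = (2 * (n : ℝ) + 1) * |a| * (|a + b| ^ (2 * n) * weight α ν (a + b)) := by ring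
    _ ≤ (2 * (n : ℝ) + 1) * |a| * ((1 + ν) * (1 + (a + b) ^ 2) ^ n * |a + b| ^ α) := by gcongr
    _ = symConst α ν n * (1 + (a + b) ^ 2) ^ n *
          (ν * (1 - (1 / 2) ^ α) * |a| * |a + b| ^ α) := by
        unfold symConst
        field_simp
    _ ≤ symConst α ν n * (1 + (a + b) ^ 2) ^ n *
          (|resonance α ν a b| * (weight α ν a * weight α ν (a + b))) := by gcongr
    _ = _ := by ring

/-- The lower bound for the resonance function without an ordering of the frequencies. The modulus
`x` is the smallest one, which the applications do not need, and `M` is the largest one. -/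
lemma resonance_lower_exists (hα : 0 < α) (hν : 0 < ν) (a b : ℝ) :
    ∃ x M : ℝ, (x = |a| ∨ x = |b| ∨ x = |a + b|) ∧ (M = |a| ∨ M = |b| ∨ M = |a + b|) ∧
      |a| ≤ M ∧ |b| ≤ M ∧ |a + b| ≤ M ∧
      ν * (1 - (1 / 2) ^ α) * x * M ^ α ≤
        |resonance α ν a b| * (weight α ν x * weight α ν M) := by
  refine frequency_induction (P := fun a b => ∃ x M : ℝ, (x = |a| ∨ x = |b| ∨ x = |a + b|) ∧
      (M = |a| ∨ M = |b| ∨ M = |a + b|) ∧ |a| ≤ M ∧ |b| ≤ M ∧ |a + b| ≤ M ∧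
      ν * (1 - (1 / 2) ^ α) * x * M ^ α ≤
        |resonance α ν a b| * (weight α ν x * weight α ν M)) ?_ ?_ ?_ a b
  · rintro a b ⟨x, M, h1, h2, h3, h4, h5, h6⟩
    rw [resonance_swap, add_comm b a]
    exact ⟨x, M, by tauto, by tauto, h4, h3, h5, h6⟩
  · rintro a b ⟨x, M, h1, h2, h3, h4, h5, h6⟩
    have e1 : |b + (-a - b)| = |a| := by rw [← abs_neg a]; congr 1; ring
    have e2 : |(-a - b)| = |a + b| := by rw [← abs_neg]; congr 1; ring
    refine ⟨x, M, ?_, ?_, h4, ?_, ?_, ?_⟩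
    · rw [e1, e2]; tauto
    · rw [e1, e2]; tauto
    · rwa [e2]
    · rwa [e1]
    · rwa [resonance_rotate]
  · intro a b h1 h2
    refine ⟨|a|, |a + b|, by tauto, by tauto, h1.trans h2, h2, le_rfl, ?_⟩
    rw [show weight α ν |a + b| = weight α ν (a + b) by simp [weight],
      show weight α ν |a| = weight α ν a by simp [weight]]
    exact resonance_lower hα hν h1 h2

/-- A bound for `(a + b) / resonance`, and so for `normalFormSymbol` up to a constant, on the
frequencies `1/R ≤ |a|, |b| ≤ R`. -/
def bandConst (α ν R : ℝ) : ℝ :=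
  (1 + 2 * R ^ 2) * weight α ν (2 * R) ^ 2 / (ν * (1 - (1 / 2) ^ α) * (1 / R) ^ α)

lemma bandConst_nonneg (hα : 0 < α) (hν : 0 < ν) {R : ℝ} (hR : 0 < R) : 0 ≤ bandConst α ν R := by
  have hc := sub_pos.2 (half_rpow_lt_one hα)
  have hw := weight_pos (α := α) hν (2 * R)
  unfold bandConst
  positivity

lemma abs_div_resonance_le (hα : 0 < α) (hν : 0 < ν) {R a b : ℝ} (hR : 0 < R)
    (ha : 1 / R ≤ |a|) (ha' : |a| ≤ R) (hb : 1 / R ≤ |b|) (hb' : |b| ≤ R) :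
    |(a + b) / resonance α ν a b| ≤ bandConst α ν R := by
  have hc := sub_pos.2 (half_rpow_lt_one hα)
  obtain ⟨x, M, hx, hM, h3, h4, h5, h6⟩ := resonance_lower_exists hα hν a b
  have hRi : 0 < 1 / R := by positivity
  have hk : |a + b| ≤ 2 * R := (abs_add_le a b).trans (by linarith)
  rcases eq_or_ne (a + b) 0 with h0 | h0
  · rw [h0, zero_div, abs_zero]
    exact bandConst_nonneg hα hν hR
  have h0' := abs_pos.2 h0
  have hM2 : M ≤ 2 * R := by rcases hM with rfl | rfl | rfl <;> linarith
  have hM0 : 1 / R ≤ M := ha.trans h3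
  have hxM : x ≤ M := by rcases hx with rfl | rfl | rfl <;> assumption
  have hx0 : 0 < x := by rcases hx with rfl | rfl | rfl <;> linarith
  have hkx : |a + b| ≤ (1 + 2 * R ^ 2) * x := by
    have key : 1 / R ≤ x → |a + b| ≤ (1 + 2 * R ^ 2) * x := fun h => by
      have e : 2 * R = 2 * R ^ 2 * (1 / R) := by field_simp
      have : 2 * R ^ 2 * (1 / R) ≤ 2 * R ^ 2 * x := by gcongr
      linarith
    -- The output frequency `a + b` is not bounded below, but then it is itself the factor `x`.
    rcases hx with rfl | rfl | rfl
    · exact key ha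
    · exact key hb
    · nlinarith [sq_nonneg R]
  have hwx : weight α ν x ≤ weight α ν (2 * R) := weight_le_weight hα hν (by
    rw [abs_of_pos hx0, abs_of_pos (by positivity)]; linarith)
  have hwM : weight α ν M ≤ weight α ν (2 * R) := weight_le_weight hα hν (by
    rw [abs_of_pos (by linarith), abs_of_pos (by positivity)]; linarith)
  have pw := weight_pos (α := α) hν (2 * R)
  have pM := weight_pos (α := α) hν M
  have hMα : (1 / R) ^ α ≤ M ^ α := Real.rpow_le_rpow hRi.le hM0 hα.le
  have pα : 0 < (1 / R) ^ α := by positivity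
  have h7 : ν * (1 - (1 / 2) ^ α) * x * (1 / R) ^ α ≤
      |resonance α ν a b| * (weight α ν (2 * R) * weight α ν (2 * R)) :=
    calc _ ≤ ν * (1 - (1 / 2) ^ α) * x * M ^ α := by gcongr
      _ ≤ _ := h6
      _ ≤ _ := by gcongr
  have hres : 0 < |resonance α ν a b| := abs_pos.2 fun h => by
    rw [h, abs_zero, zero_mul] at h7
    exact absurd h7 (not_le.2 (by positivity))
  rw [abs_div, div_le_iff₀ hres, bandConst, div_mul_eq_mul_div, le_div_iff₀ (by positivity)]
  calc |a + b| * (ν * (1 - (1 / 2) ^ α) * (1 / R) ^ α)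
      ≤ (1 + 2 * R ^ 2) * x * (ν * (1 - (1 / 2) ^ α) * (1 / R) ^ α) := by gcongr
    _ = (1 + 2 * R ^ 2) * (ν * (1 - (1 / 2) ^ α) * x * (1 / R) ^ α) := by ring
    _ ≤ (1 + 2 * R ^ 2) * (|resonance α ν a b| * (weight α ν (2 * R) * weight α ν (2 * R))) := by
        gcongr
    _ = _ := by ring

lemma abs_normalFormSymbol_le (hα : 0 < α) (hν : 0 < ν) (κ lam μ : ℝ) {R a b : ℝ} (hR : 0 < R)
    (ha : 1 / R ≤ |a|) (ha' : |a| ≤ R) (hb : 1 / R ≤ |b|) (hb' : |b| ≤ R) :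
    |normalFormSymbol α κ lam μ ν a b| ≤
      |lam * ν / (2 * (κ * ν + μ))| * bandConst α ν R := by
  have h := congrArg abs (weight_mul_normalFormSymbol (α := α) hν κ lam μ a b)
  rw [abs_mul, abs_mul, abs_of_pos (weight_pos hν _)] at h
  calc |normalFormSymbol α κ lam μ ν a b|
      ≤ weight α ν (a + b) * |normalFormSymbol α κ lam μ ν a b| :=
        le_mul_of_one_le_left (abs_nonneg _) (one_le_weight hν _)
    _ ≤ _ := by
        rw [h]
        gcongr
        exact abs_div_resonance_le hα hν hR ha ha' hb hb'

end bounds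

/-! ### Trilinear integrals over `a + b + c = 0` -/

/-- The rotation `(a, b) ↦ (b, c)` of three frequencies with `a + b + c = 0`. -/
def rotate (p : ℝ × ℝ) : ℝ × ℝ := (p.2, -p.1 - p.2)

lemma measurePreserving_rotate : MeasurePreserving rotate (volume : Measure (ℝ × ℝ)) volume := by
  have h1 := measurePreserving_prod_add_swap (volume : Measure ℝ) (volume : Measure ℝ)
  have h2 := (MeasurePreserving.id (volume : Measure ℝ)).prod
    (Measure.measurePreserving_neg (volume : Measure ℝ))
  have e : rotate = Prod.map id Neg.neg ∘ fun z : ℝ × ℝ => (z.2, z.2 + z.1) := by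
    ext p
    · rfl
    · simp only [rotate, Function.comp_apply, Prod.map_snd]
      ring
  rw [e]
  exact h2.comp h1

lemma measurableEmbedding_rotate : MeasurableEmbedding rotate := by
  refine Continuous.measurableEmbedding (by unfold rotate; fun_prop) fun p q h => ?_
  simp only [rotate, Prod.mk.injEq] at h
  ext <;> linarith [h.1, h.2]

lemma integrable_comp_rotate {E : Type*} [NormedAddCommGroup E] {F : ℝ × ℝ → E}
    (hF : Integrable F) : Integrable (F ∘ rotate) :=
  (measurePreserving_rotate.integrable_comp_emb measurableEmbedding_rotate).2 hF

lemma integral_comp_rotate {E : Type*} [NormedAddCommGroup E] [NormedSpace ℝ E] (F : ℝ × ℝ → E) :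
    ∫ p, F (rotate p) = ∫ p, F p :=
  measurePreserving_rotate.integral_comp measurableEmbedding_rotate F

/-- The sum of `A x * G y` over the pairs of distinct entries `x`, `y` of `(a, b, -a-b)`. -/
def pairSum (A G : ℝ → ℝ) (a b : ℝ) : ℝ :=
  A a * (G b + G (-a - b)) + A b * (G a + G (-a - b)) + A (-a - b) * (G a + G b)

lemma pairSum_eq (A G : ℝ → ℝ) : (fun p : ℝ × ℝ => pairSum A G p.1 p.2) =
    fun p => ((fun p : ℝ × ℝ => A p.1 * G p.2) p + ((fun p : ℝ × ℝ => A p.1 * G p.2) ∘ rotate) p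
      + ((fun p : ℝ × ℝ => A p.1 * G p.2) ∘ rotate ∘ rotate) p)
    + ((fun p : ℝ × ℝ => G p.1 * A p.2) p + ((fun p : ℝ × ℝ => G p.1 * A p.2) ∘ rotate) p
      + ((fun p : ℝ × ℝ => G p.1 * A p.2) ∘ rotate ∘ rotate) p) := by
  ext ⟨a, b⟩
  have h : -b - (-a - b) = a := by ring
  simp only [pairSum, rotate, Function.comp_apply, h]
  ring

lemma integrable_sum_rotate {F : ℝ × ℝ → ℝ} (hF : Integrable F) :
    Integrable fun p => F p + (F ∘ rotate) p + (F ∘ rotate ∘ rotate) p :=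
  (hF.add (integrable_comp_rotate hF)).add (integrable_comp_rotate (integrable_comp_rotate hF))

lemma integral_sum_rotate {E : Type*} [NormedAddCommGroup E] [NormedSpace ℝ E] {F : ℝ × ℝ → E}
    (hF : Integrable F) :
    ∫ p, (F p + (F ∘ rotate) p + (F ∘ rotate ∘ rotate) p) = (3 : ℝ) • ∫ p, F p := by
  have h1 := integrable_comp_rotate hF
  have h2 : Integrable (F ∘ rotate ∘ rotate) := integrable_comp_rotate h1
  have e1 : ∫ p, (F ∘ rotate) p = ∫ p, F p := integral_comp_rotate F
  have e2 : ∫ p, (F ∘ rotate ∘ rotate) p = ∫ p, F p :=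
    (integral_comp_rotate (F ∘ rotate)).trans e1
  rw [integral_add (f := fun p => F p + (F ∘ rotate) p) (hF.add h1) h2,
    integral_add hF h1, e1, e2]
  module

lemma integrable_pairSum {A G : ℝ → ℝ} (hA : Integrable A) (hG : Integrable G) :
    Integrable fun p : ℝ × ℝ => pairSum A G p.1 p.2 := by
  rw [pairSum_eq]
  exact (integrable_sum_rotate (hA.mul_prod hG)).add (integrable_sum_rotate (hG.mul_prod hA))

lemma integral_pairSum {A G : ℝ → ℝ} (hA : Integrable A) (hG : Integrable G) :
    ∫ p : ℝ × ℝ, pairSum A G p.1 p.2 = 6 * ((∫ x, A x) * ∫ x, G x) := by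
  rw [pairSum_eq, integral_add (integrable_sum_rotate (hA.mul_prod hG))
    (integrable_sum_rotate (hG.mul_prod hA)), integral_sum_rotate (hA.mul_prod hG),
    integral_sum_rotate (hG.mul_prod hA)]
  have e1 : ∫ p : ℝ × ℝ, A p.1 * G p.2 = (∫ x, A x) * ∫ x, G x := integral_prod_mul A G
  have e2 : ∫ p : ℝ × ℝ, G p.1 * A p.2 = (∫ x, G x) * ∫ x, A x := integral_prod_mul G A
  rw [e1, e2, smul_eq_mul, smul_eq_mul]
  ring

/-- The product `w(a) w(b) w(c)` over `a + b + c = 0`. -/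
def tripleProduct (w : ℝ → ℂ) (a b : ℝ) : ℂ := w a * w b * w (-a - b)

lemma tripleProduct_swap (w : ℝ → ℂ) (a b : ℝ) : tripleProduct w b a = tripleProduct w a b := by
  have h : -b - a = -a - b := by ring
  rw [tripleProduct, h, tripleProduct]
  ring

lemma tripleProduct_rotate (w : ℝ → ℂ) (a b : ℝ) :
    tripleProduct w b (-a - b) = tripleProduct w a b := by
  have h : -b - (-a - b) = a := by ring
  rw [tripleProduct, h, tripleProduct]
  ring

lemma stronglyMeasurable_tripleProduct {w : ℝ → ℂ} (hw : StronglyMeasurable w) :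
    StronglyMeasurable fun p : ℝ × ℝ => tripleProduct w p.1 p.2 :=
  ((hw.comp_measurable measurable_fst).mul (hw.comp_measurable measurable_snd)).mul
    (hw.comp_measurable (by fun_prop))

section pointwise

variable {α ν : ℝ}

/-- The pointwise bound behind all trilinear estimates: the two factors with the largest
frequencies are decoupled by the inequality between the arithmetic and the geometric mean. -/
lemma norm_symSymbol_mul_tripleProduct_le (hα : 0 < α) (hα1 : α < 1) (hν : 0 < ν) {n : ℕ}
    (hn : 1 ≤ n) (w : ℝ → ℂ) (a b : ℝ) :
    ‖(symSymbol α ν (2 * n + 1) a b : ℂ) * tripleProduct w a b‖ ≤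
      symConst α ν n * 4 ^ n *
        pairSum (fun t => weight α ν t * ‖w t‖) (fun t => (1 + t ^ 2) ^ n * ‖w t‖ ^ 2) a b := by
  refine frequency_induction (P := fun a b =>
    ‖(symSymbol α ν (2 * n + 1) a b : ℂ) * tripleProduct w a b‖ ≤
      symConst α ν n * 4 ^ n *
        pairSum (fun t => weight α ν t * ‖w t‖) (fun t => (1 + t ^ 2) ^ n * ‖w t‖ ^ 2) a b)
    ?_ ?_ ?_ a b
  · intro a b h
    have e : -b - a = -a - b := by ring
    rw [symSymbol_swap, tripleProduct_swap]
    refine h.trans_eq ?_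
    simp only [pairSum, e]
    ring
  · intro a b h
    have e : -b - (-a - b) = a := by ring
    rw [symSymbol_rotate ⟨n, rfl⟩, tripleProduct_rotate]
    refine h.trans_eq ?_
    simp only [pairSum, e]
    ring
  · intro a b h1 h2
    have hK := symConst_pos hα hν n
    have hwt := fun t => (weight_pos (α := α) hν t).le
    have hb : (1 + (a + b) ^ 2) ^ n ≤ 4 ^ n * (1 + b ^ 2) ^ n := by
      rw [← mul_pow]
      gcongr
      have : |a + b| ≤ 2 * |b| := (abs_add_le a b).trans (by linarith)
      have : (a + b) ^ 2 ≤ (2 * |b|) ^ 2 := by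
        rw [← sq_abs (a + b)]
        gcongr
      rw [mul_pow, sq_abs] at this
      linarith
    have hc : (1 + (a + b) ^ 2) ^ n ≤ 4 ^ n * (1 + (-a - b) ^ 2) ^ n := by
      have e : (-a - b) ^ 2 = (a + b) ^ 2 := by ring
      rw [e]
      exact le_mul_of_one_le_left (by positivity) (one_le_pow₀ (by norm_num))
    have hamgm : (1 + (a + b) ^ 2) ^ n * (‖w b‖ * ‖w (-a - b)‖) ≤
        4 ^ n * ((1 + b ^ 2) ^ n * ‖w b‖ ^ 2 + (1 + (-a - b) ^ 2) ^ n * ‖w (-a - b)‖ ^ 2) :=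
      calc (1 + (a + b) ^ 2) ^ n * (‖w b‖ * ‖w (-a - b)‖)
          ≤ (1 + (a + b) ^ 2) ^ n * (‖w b‖ ^ 2 + ‖w (-a - b)‖ ^ 2) := by
            gcongr
            nlinarith [sq_nonneg (‖w b‖ - ‖w (-a - b)‖), sq_nonneg ‖w b‖, sq_nonneg ‖w (-a - b)‖]
        _ = (1 + (a + b) ^ 2) ^ n * ‖w b‖ ^ 2 + (1 + (a + b) ^ 2) ^ n * ‖w (-a - b)‖ ^ 2 := by ring
        _ ≤ 4 ^ n * (1 + b ^ 2) ^ n * ‖w b‖ ^ 2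
              + 4 ^ n * (1 + (-a - b) ^ 2) ^ n * ‖w (-a - b)‖ ^ 2 := by gcongr
        _ = _ := by ring
    rw [norm_mul, Complex.norm_real, Real.norm_eq_abs, tripleProduct, norm_mul, norm_mul]
    calc |symSymbol α ν (2 * n + 1) a b| * (‖w a‖ * ‖w b‖ * ‖w (-a - b)‖)
        ≤ symConst α ν n * weight α ν a * (1 + (a + b) ^ 2) ^ n *
            (‖w a‖ * ‖w b‖ * ‖w (-a - b)‖) := by
          gcongr
          exact abs_symSymbol_le hα hα1 hν hn h1 h2
      _ = symConst α ν n * (weight α ν a * ‖w a‖) *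
            ((1 + (a + b) ^ 2) ^ n * (‖w b‖ * ‖w (-a - b)‖)) := by ring
      _ ≤ symConst α ν n * (weight α ν a * ‖w a‖) *
            (4 ^ n * ((1 + b ^ 2) ^ n * ‖w b‖ ^ 2 +
              (1 + (-a - b) ^ 2) ^ n * ‖w (-a - b)‖ ^ 2)) := by
          have := hwt a
          gcongr
      _ = symConst α ν n * 4 ^ n * ((weight α ν a * ‖w a‖) *
            ((1 + b ^ 2) ^ n * ‖w b‖ ^ 2 + (1 + (-a - b) ^ 2) ^ n * ‖w (-a - b)‖ ^ 2)) := by ring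
      _ ≤ _ := by
          have h3 := hwt a
          have h4 := hwt b
          have h5 := hwt (-a - b)
          unfold pairSum
          rw [add_assoc]
          gcongr
          exact le_add_of_nonneg_right (by positivity)

end pointwise

section sobolev

variable {α ν s : ℝ} {w : ℝ → ℂ}

lemma weight_le (hα : 0 < α) (hν : 0 < ν) (t : ℝ) :
    weight α ν t ≤ (1 + ν) * (1 + t ^ 2) ^ (α / 2) := by
  have h1 : 1 ≤ (1 + t ^ 2) ^ (α / 2) := Real.one_le_rpow (by nlinarith) (by positivity)
  have h2 : |t| ^ α ≤ (1 + t ^ 2) ^ (α / 2) := by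
    have e : |t| ^ α = (t ^ 2) ^ (α / 2) := by
      rw [← sq_abs, ← Real.rpow_natCast_mul (abs_nonneg t)]
      congr 1
      push_cast
      ring
    rw [e]
    gcongr
    linarith
  unfold weight
  nlinarith

/-- The constant of the embedding `‖(1 + ν|k|^α) û‖_{L¹} ≤ C ‖u‖_{H^s}`. -/
def embeddingConst (α ν s : ℝ) : ℝ :=
  (1 + ν) * (∫ t : ℝ, (1 + t ^ 2) ^ (α - s)) ^ (1 / 2 : ℝ)

lemma embeddingConst_nonneg (hν : 0 < ν) : 0 ≤ embeddingConst α ν s := by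
  have : 0 ≤ ∫ t : ℝ, (1 + t ^ 2) ^ (α - s) := integral_nonneg fun t => by positivity
  unfold embeddingConst
  positivity

lemma integrable_weight_mul_norm (hα : 0 < α) (hν : 0 < ν) (hs : 1 / 2 < s - α)
    (hw : StronglyMeasurable w) (hi : Integrable fun k : ℝ => (1 + k ^ 2) ^ s * ‖w k‖ ^ 2) :
    Integrable (fun t => weight α ν t * ‖w t‖) ∧
    ∫ t, weight α ν t * ‖w t‖ ≤
      embeddingConst α ν s * (∫ k : ℝ, (1 + k ^ 2) ^ s * ‖w k‖ ^ 2) ^ (1 / 2 : ℝ) := by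
  set f : ℝ → ℝ := fun t => (1 + t ^ 2) ^ ((α - s) / 2) with hf
  set g : ℝ → ℝ := fun t => (1 + t ^ 2) ^ (s / 2) * ‖w t‖ with hg
  have hfm : Measurable f := by fun_prop
  have hgm : AEStronglyMeasurable g volume :=
    ((by fun_prop : Measurable fun t : ℝ => (1 + t ^ 2) ^ (s / 2)).stronglyMeasurable.mul
      hw.norm).aestronglyMeasurable
  have hf2 : ∀ t, f t ^ 2 = (1 + t ^ 2) ^ (α - s) := fun t => by
    rw [hf, ← Real.rpow_mul_natCast (by positivity)]
    congr 1
    push_cast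
    ring
  have hg2 : ∀ t, g t ^ 2 = (1 + t ^ 2) ^ s * ‖w t‖ ^ 2 := fun t => by
    rw [hg, mul_pow, ← Real.rpow_mul_natCast (by positivity)]
    congr 2
    push_cast
    ring
  have hfL : MemLp f 2 volume := by
    rw [memLp_two_iff_integrable_sq hfm.aestronglyMeasurable]
    simp only [hf2]
    have h := integrable_rpow_neg_one_add_norm_sq (E := ℝ) (μ := volume) (r := 2 * (s - α))
      (by simp; linarith)
    refine h.congr (Eventually.of_forall fun t => ?_)
    simp only [Real.norm_eq_abs, sq_abs]
    congr 1
    ring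
  have hgL : MemLp g 2 volume := by
    rw [memLp_two_iff_integrable_sq hgm]
    simpa only [hg2] using hi
  have hfg : Integrable fun t => f t * g t := hfL.integrable_mul hgL
  have hle : ∀ t, weight α ν t * ‖w t‖ ≤ (1 + ν) * (f t * g t) := fun t => by
    have e : f t * g t = (1 + t ^ 2) ^ (α / 2) * ‖w t‖ := by
      rw [hf, hg, ← mul_assoc, ← Real.rpow_add (by positivity)]
      congr 2
      ring
    rw [e, ← mul_assoc]
    gcongr
    exact weight_le hα hν t
  have hint : Integrable fun t => weight α ν t * ‖w t‖ := by
    refine (hfg.const_mul (1 + ν)).mono'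
      (measurable_weight.stronglyMeasurable.mul hw.norm).aestronglyMeasurable
      (Eventually.of_forall fun t => ?_)
    rw [Real.norm_eq_abs, abs_of_nonneg (mul_nonneg (weight_pos hν t).le (norm_nonneg _))]
    exact hle t
  refine ⟨hint, ?_⟩
  have hH := integral_mul_le_Lp_mul_Lq_of_nonneg (μ := volume) Real.HolderConjugate.two_two
    (Eventually.of_forall fun t => by positivity : 0 ≤ᵐ[volume] f)
    (Eventually.of_forall fun t => by positivity : 0 ≤ᵐ[volume] g)
    (by simpa using hfL) (by simpa using hgL)
  simp only [Real.rpow_two, hf2, hg2] at hH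
  calc ∫ t, weight α ν t * ‖w t‖ ≤ ∫ t, (1 + ν) * (f t * g t) :=
        integral_mono hint (hfg.const_mul _) hle
    _ = (1 + ν) * ∫ t, f t * g t := integral_const_mul _ _
    _ ≤ _ := by
        rw [embeddingConst, mul_assoc]
        gcongr

lemma integrable_pow_mul_norm_sq {n : ℕ} (hn : (n : ℝ) ≤ s) (hw : StronglyMeasurable w)
    (hi : Integrable fun k : ℝ => (1 + k ^ 2) ^ s * ‖w k‖ ^ 2) :
    Integrable (fun t : ℝ => (1 + t ^ 2) ^ n * ‖w t‖ ^ 2) ∧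
    ∫ t : ℝ, (1 + t ^ 2) ^ n * ‖w t‖ ^ 2 ≤ ∫ k : ℝ, (1 + k ^ 2) ^ s * ‖w k‖ ^ 2 := by
  have hle : ∀ t : ℝ, (1 + t ^ 2) ^ n * ‖w t‖ ^ 2 ≤ (1 + t ^ 2) ^ s * ‖w t‖ ^ 2 := fun t => by
    rw [← Real.rpow_natCast]
    gcongr
    nlinarith
  have hint : Integrable (fun t : ℝ => (1 + t ^ 2) ^ n * ‖w t‖ ^ 2) := by
    refine hi.mono' ((by fun_prop : Measurable fun t : ℝ => (1 + t ^ 2) ^ n).stronglyMeasurable.mul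
      (hw.norm.pow 2)).aestronglyMeasurable (Eventually.of_forall fun t => ?_)
    rw [Real.norm_eq_abs, abs_of_nonneg (by positivity)]
    exact hle t
  exact ⟨hint, integral_mono hint hi hle⟩

/-- The constant of the trilinear estimate. -/
def trilinearConst (α ν s : ℝ) (n : ℕ) : ℝ := 6 * (symConst α ν n * 4 ^ n) * embeddingConst α ν s

/-- The symmetrized trilinear form converges absolutely on `H^s`, and it is cubic in the norm. -/
lemma integrable_symSymbol_mul_tripleProduct (hα : 0 < α) (hα1 : α < 1) (hν : 0 < ν) {n : ℕ}
    (hn : 1 ≤ n) (hns : (n : ℝ) ≤ s) (hs : 1 / 2 < s - α) (hw : StronglyMeasurable w)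
    (hi : Integrable fun k : ℝ => (1 + k ^ 2) ^ s * ‖w k‖ ^ 2) :
    Integrable (fun p : ℝ × ℝ =>
      (symSymbol α ν (2 * n + 1) p.1 p.2 : ℂ) * tripleProduct w p.1 p.2) ∧
    ‖∫ p : ℝ × ℝ, (symSymbol α ν (2 * n + 1) p.1 p.2 : ℂ) * tripleProduct w p.1 p.2‖ ≤
      trilinearConst α ν s n * (∫ k : ℝ, (1 + k ^ 2) ^ s * ‖w k‖ ^ 2) ^ (1 / 2 : ℝ) *
        ∫ k : ℝ, (1 + k ^ 2) ^ s * ‖w k‖ ^ 2 := by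
  obtain ⟨hA, hA'⟩ := integrable_weight_mul_norm hα hν hs hw hi
  obtain ⟨hG, hG'⟩ := integrable_pow_mul_norm_sq hns hw hi
  have hP := (integrable_pairSum hA hG).const_mul (symConst α ν n * 4 ^ n)
  have hle := fun p : ℝ × ℝ => norm_symSymbol_mul_tripleProduct_le hα hα1 hν hn w p.1 p.2
  have hm : AEStronglyMeasurable (fun p : ℝ × ℝ =>
      (symSymbol α ν (2 * n + 1) p.1 p.2 : ℂ) * tripleProduct w p.1 p.2) volume :=
    ((Complex.measurable_ofReal.comp (measurable_symSymbol _)).stronglyMeasurable.mul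
      (stronglyMeasurable_tripleProduct hw)).aestronglyMeasurable
  have hK := symConst_pos hα hν n
  have hQ : 0 ≤ ∫ k : ℝ, (1 + k ^ 2) ^ s * ‖w k‖ ^ 2 := integral_nonneg fun k => by positivity
  have hA0 : 0 ≤ ∫ t, weight α ν t * ‖w t‖ :=
    integral_nonneg fun t => mul_nonneg (weight_pos hν t).le (norm_nonneg _)
  refine ⟨hP.mono' hm (Eventually.of_forall hle), ?_⟩
  calc _ ≤ ∫ p : ℝ × ℝ, symConst α ν n * 4 ^ n * pairSum (fun t => weight α ν t * ‖w t‖)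
          (fun t => (1 + t ^ 2) ^ n * ‖w t‖ ^ 2) p.1 p.2 :=
        norm_integral_le_of_norm_le hP (Eventually.of_forall hle)
    _ = symConst α ν n * 4 ^ n * (6 * ((∫ t, weight α ν t * ‖w t‖) *
          ∫ t : ℝ, (1 + t ^ 2) ^ n * ‖w t‖ ^ 2)) := by
        rw [integral_const_mul, integral_pairSum hA hG]
    _ ≤ symConst α ν n * 4 ^ n * (6 * ((embeddingConst α ν s *
          (∫ k : ℝ, (1 + k ^ 2) ^ s * ‖w k‖ ^ 2) ^ (1 / 2 : ℝ)) *
          ∫ k : ℝ, (1 + k ^ 2) ^ s * ‖w k‖ ^ 2)) := by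
        have h1 := mul_le_mul hA' hG' (integral_nonneg fun k => by positivity) (hA0.trans hA')
        gcongr
    _ = _ := by
        unfold trilinearConst
        ring

end sobolev

/-! ### The pairing of band-limited functions -/

section multipliers

variable {α ν : ℝ}

lemma hat_sqrtOp {f : L2C}
    (h : MemLp (fun k => ((Real.sqrt (weight α ν k) : ℝ) : ℂ) * hat f k) 2 volume) :
    hat (sqrtOp α ν f) =ᵐ[volume] fun k => ((Real.sqrt (weight α ν k) : ℝ) : ℂ) * hat f k :=
  hat_multiplier h

lemma hat_dx_sqrtOp {n : ℕ} {f : L2C}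
    (h : MemLp (fun k => ((Real.sqrt (weight α ν k) : ℝ) : ℂ) * hat f k) 2 volume)
    (h' : MemLp (fun k : ℝ => (Complex.I * (k : ℂ)) ^ n *
      (((Real.sqrt (weight α ν k) : ℝ) : ℂ) * hat f k)) 2 volume) :
    hat (dx n (sqrtOp α ν f)) =ᵐ[volume] fun k : ℝ => (Complex.I * (k : ℂ)) ^ n *
      (((Real.sqrt (weight α ν k) : ℝ) : ℂ) * hat f k) := by
  have h1 : (fun k : ℝ => (Complex.I * (k : ℂ)) ^ n * hat (sqrtOp α ν f) k) =ᵐ[volume]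
      fun k : ℝ => (Complex.I * (k : ℂ)) ^ n *
        (((Real.sqrt (weight α ν k) : ℝ) : ℂ) * hat f k) := by
    filter_upwards [hat_sqrtOp h] with k hk
    rw [hk]
  exact (hat_multiplier (h'.ae_eq h1.symm)).trans h1

lemma continuous_weight (hα : 0 < α) : Continuous (weight α ν) := by
  unfold weight
  exact continuous_const.add (continuous_const.mul
    (continuous_abs.rpow_const fun _ => Or.inr hα.le))

lemma MemLp.continuous_mul {p w : ℝ → ℂ} {T : ℝ} (hp : Continuous p) (hw : MemLp w 2 volume)
    (hsupp : ∀ k, w k ≠ 0 → |k| ≤ T) : MemLp (fun k => p k * w k) 2 volume := by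
  obtain ⟨B, hB⟩ := (isCompact_Icc (a := -T) (b := T)).exists_bound_of_continuousOn hp.continuousOn
  refine hw.of_le_mul (c := B) (hp.aestronglyMeasurable.mul hw.1) (Eventually.of_forall fun k => ?_)
  by_cases h : w k = 0
  · simp [h]
  · rw [norm_mul]
    gcongr
    exact hB k (abs_le.1 (hsupp k h))

lemma hat_dx_sqrtOp_of_support (hα : 0 < α) (n : ℕ) {f : L2C} {w : ℝ → ℂ} {T : ℝ}
    (hw : MemLp w 2 volume) (hf : hat f =ᵐ[volume] w) (hsupp : ∀ k, w k ≠ 0 → |k| ≤ T) :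
    hat (dx n (sqrtOp α ν f)) =ᵐ[volume] fun k : ℝ => (Complex.I * (k : ℂ)) ^ n *
      (((Real.sqrt (weight α ν k) : ℝ) : ℂ) * w k) := by
  have hc : Continuous fun k => ((Real.sqrt (weight α ν k) : ℝ) : ℂ) :=
    Complex.continuous_ofReal.comp (continuous_weight hα).sqrt
  have h1 : MemLp (fun k => ((Real.sqrt (weight α ν k) : ℝ) : ℂ) * w k) 2 volume :=
    MemLp.continuous_mul hc hw hsupp
  have h2 : MemLp (fun k : ℝ => (Complex.I * (k : ℂ)) ^ n *
      (((Real.sqrt (weight α ν k) : ℝ) : ℂ) * w k)) 2 volume :=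
    MemLp.continuous_mul (by fun_prop) h1 fun k hk => hsupp k (right_ne_zero_of_mul hk)
  have e1 : (fun k => ((Real.sqrt (weight α ν k) : ℝ) : ℂ) * w k) =ᵐ[volume]
      fun k => ((Real.sqrt (weight α ν k) : ℝ) : ℂ) * hat f k := by
    filter_upwards [hf] with k hk
    rw [hk]
  have e2 : (fun k : ℝ => (Complex.I * (k : ℂ)) ^ n *
      (((Real.sqrt (weight α ν k) : ℝ) : ℂ) * w k)) =ᵐ[volume]
      fun k : ℝ => (Complex.I * (k : ℂ)) ^ n *
      (((Real.sqrt (weight α ν k) : ℝ) : ℂ) * hat f k) := by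
    filter_upwards [hf] with k hk
    rw [hk]
  exact (hat_dx_sqrtOp (h1.ae_eq e1) (h2.ae_eq e2)).trans e2.symm

end multipliers

/-- The trilinear form `∫∫ symSymbol(a, b) w(a) w(b) w(-a-b) da db`. -/
def trilinear (α ν : ℝ) (n : ℕ) (w : ℝ → ℂ) : ℂ :=
  ∫ p : ℝ × ℝ, (symSymbol α ν (2 * n + 1) p.1 p.2 : ℂ) * tripleProduct w p.1 p.2

/-- The Fourier transform of the pseudo-product of a function with Fourier transform `w`. -/
def pseudoConv (α κ lam μ ν : ℝ) (w : ℝ → ℂ) (k : ℝ) : ℂ :=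
  ∫ l : ℝ, (normalFormSymbol α κ lam μ ν (k - l) l : ℂ) * w (k - l) * w l

section band

variable {α κ lam μ ν R : ℝ} {w : ℝ → ℂ}

lemma measurable_normalFormSymbol :
    Measurable fun p : ℝ × ℝ => normalFormSymbol α κ lam μ ν p.1 p.2 := by
  unfold normalFormSymbol
  fun_prop

/-- The integrals agree for every `k`, not only almost everywhere. -/
lemma pseudoProduct_eq {v : L2C} (hv : hat v =ᵐ[volume] w) :
    pseudoProduct α κ lam μ ν v v = invHat (pseudoConv α κ lam μ ν w) := by
  unfold pseudoProduct pseudoConv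
  congr 1
  funext k
  have h := (quasiMeasurePreserving_sub_left (volume : Measure ℝ) k).ae hv
  refine integral_congr_ae ?_
  filter_upwards [hv, h] with l h1 h2
  rw [h1, h2]

lemma stronglyMeasurable_pseudoConv (hw : StronglyMeasurable w) :
    StronglyMeasurable (pseudoConv α κ lam μ ν w) := by
  have h1 : Measurable fun p : ℝ × ℝ => normalFormSymbol α κ lam μ ν (p.1 - p.2) p.2 :=
    measurable_normalFormSymbol.comp (by fun_prop : Measurable fun p : ℝ × ℝ => (p.1 - p.2, p.2))
  have h2 : StronglyMeasurable fun p : ℝ × ℝ =>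
      (normalFormSymbol α κ lam μ ν (p.1 - p.2) p.2 : ℂ) * w (p.1 - p.2) * w p.2 :=
    ((Complex.measurable_ofReal.comp h1).stronglyMeasurable.mul
      (hw.comp_measurable (by fun_prop))).mul (hw.comp_measurable measurable_snd)
  exact h2.integral_prod_right'

lemma norm_normalFormSymbol_mul_le (hα : 0 < α) (hν : 0 < ν) (hR : 0 < R)
    (hsupp : ∀ k, w k ≠ 0 → 1 / R ≤ |k| ∧ |k| ≤ R) (a b : ℝ) :
    ‖(normalFormSymbol α κ lam μ ν a b : ℂ) * w a * w b‖ ≤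
      |lam * ν / (2 * (κ * ν + μ))| * bandConst α ν R * (‖w a‖ ^ 2 + ‖w b‖ ^ 2) := by
  have hK : 0 ≤ |lam * ν / (2 * (κ * ν + μ))| * bandConst α ν R :=
    mul_nonneg (abs_nonneg _) (bandConst_nonneg hα hν hR)
  by_cases ha : w a = 0
  · simp only [ha, mul_zero, zero_mul, norm_zero]
    positivity
  by_cases hb : w b = 0
  · simp only [hb, mul_zero, norm_zero]
    positivity
  rw [norm_mul, norm_mul, Complex.norm_real, Real.norm_eq_abs, mul_assoc]
  refine mul_le_mul ?_ ?_ (by positivity) hK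
  · exact abs_normalFormSymbol_le hα hν κ lam μ hR (hsupp a ha).1 (hsupp a ha).2
      (hsupp b hb).1 (hsupp b hb).2
  · nlinarith [sq_nonneg (‖w a‖ - ‖w b‖), sq_nonneg ‖w a‖, sq_nonneg ‖w b‖]

lemma pseudoConv_support (hsupp : ∀ k, w k ≠ 0 → 1 / R ≤ |k| ∧ |k| ≤ R) (k : ℝ)
    (hk : pseudoConv α κ lam μ ν w k ≠ 0) : |k| ≤ 2 * R := by
  by_contra! h
  refine hk ?_
  unfold pseudoConv
  rw [← integral_zero ℝ ℂ (μ := volume)]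
  congr 1
  funext l
  by_cases h1 : w (k - l) = 0
  · simp [h1]
  by_cases h2 : w l = 0
  · simp [h2]
  have h3 := (hsupp _ h1).2
  have h4 := (hsupp _ h2).2
  have h5 := abs_add_le (k - l) l
  rw [sub_add_cancel] at h5
  linarith

/-- A pseudo-product of band-limited functions is an honest square integrable function. -/
lemma memLp_pseudoConv (hα : 0 < α) (hν : 0 < ν) (hR : 0 < R) (hw : StronglyMeasurable w)
    (hw2 : MemLp w 2 volume) (hsupp : ∀ k, w k ≠ 0 → 1 / R ≤ |k| ∧ |k| ≤ R) :
    MemLp (pseudoConv α κ lam μ ν w) 2 volume := by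
  have hi : Integrable fun k => ‖w k‖ ^ 2 := (memLp_two_iff_integrable_sq_norm hw2.1).1 hw2
  set K := |lam * ν / (2 * (κ * ν + μ))| * bandConst α ν R
  set B := ∫ k, ‖w k‖ ^ 2
  have hb : ∀ k, ‖pseudoConv α κ lam μ ν w k‖ ≤ K * (B + B) := fun k => by
    have hi' : Integrable fun l => ‖w (k - l)‖ ^ 2 := hi.comp_sub_left k
    have h := norm_integral_le_of_norm_le ((hi'.add hi).const_mul K)
      (Eventually.of_forall fun l =>
        norm_normalFormSymbol_mul_le (κ := κ) (lam := lam) (μ := μ) hα hν hR hsupp (k - l) l)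
    refine h.trans_eq ?_
    simp only [Pi.add_apply]
    rw [integral_const_mul, integral_add hi' hi,
      integral_sub_left_eq_self (fun l => ‖w l‖ ^ 2) volume k]
  have h1 : MemLp (Set.indicator (Set.Icc (-(2 * R)) (2 * R)) fun _ => K * (B + B)) 2
      (volume : Measure ℝ) :=
    memLp_indicator_const 2 measurableSet_Icc _ (Or.inr (by simp))
  refine h1.mono' (stronglyMeasurable_pseudoConv hw).aestronglyMeasurable
    (Eventually.of_forall fun k => ?_)
  by_cases h : pseudoConv α κ lam μ ν w k = 0
  · rw [h, norm_zero]
    exact Set.indicator_nonneg (fun _ _ => (norm_nonneg _).trans (hb k)) k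
  · rw [Set.indicator_of_mem (Set.mem_Icc.2 <| abs_le.1 (pseudoConv_support hsupp k h))]
    exact hb k

lemma integrable_tripleProduct (hw : StronglyMeasurable w) (hw2 : MemLp w 2 volume)
    (hsupp : ∀ k, w k ≠ 0 → |k| ≤ R) :
    Integrable fun p : ℝ × ℝ => tripleProduct w p.1 p.2 := by
  have hi : Integrable fun k => ‖w k‖ ^ 2 := (memLp_two_iff_integrable_sq_norm hw2.1).1 hw2
  have h1 : Integrable fun k => ‖w k‖ := by
    have hI : Integrable (Set.indicator (Set.Icc (-R) R) fun _ => (1 : ℝ)) :=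
      (integrable_indicator_iff measurableSet_Icc).2 (by simp)
    refine (hI.add hi).mono' hw.norm.aestronglyMeasurable (Eventually.of_forall fun k => ?_)
    rw [norm_norm, Pi.add_apply]
    by_cases h : w k = 0
    · rw [h, norm_zero]
      exact add_nonneg (Set.indicator_nonneg (fun _ _ => zero_le_one) _) (by positivity)
    · rw [Set.indicator_of_mem (Set.mem_Icc.2 <| abs_le.1 (hsupp k h))]
      nlinarith [sq_nonneg (‖w k‖ - 1)]
  refine (integrable_pairSum h1 hi).mono' (stronglyMeasurable_tripleProduct hw).aestronglyMeasurable
    (Eventually.of_forall fun p => ?_)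
  have h2 : 0 ≤ ‖w p.2‖ * (‖w p.1‖ ^ 2 + ‖w (-p.1 - p.2)‖ ^ 2)
      + ‖w (-p.1 - p.2)‖ * (‖w p.1‖ ^ 2 + ‖w p.2‖ ^ 2) := by positivity
  have h3 : ‖w p.2‖ * ‖w (-p.1 - p.2)‖ ≤ ‖w p.2‖ ^ 2 + ‖w (-p.1 - p.2)‖ ^ 2 := by
    nlinarith [sq_nonneg (‖w p.2‖ - ‖w (-p.1 - p.2)‖), sq_nonneg ‖w p.2‖,
      sq_nonneg ‖w (-p.1 - p.2)‖]
  have h4 := mul_le_mul_of_nonneg_left h3 (norm_nonneg (w p.1))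
  rw [tripleProduct, norm_mul, norm_mul, pairSum]
  linarith

/-- The integrand of the pairing, before symmetrization. -/
def pairingIntegrand (α ν : ℝ) (n : ℕ) (w : ℝ → ℂ) (p : ℝ × ℝ) : ℂ :=
  (((p.1 + p.2) ^ (2 * n + 1) / resonance α ν p.1 p.2 : ℝ) : ℂ) * tripleProduct w p.1 p.2

lemma integrable_pairingIntegrand (hα : 0 < α) (hν : 0 < ν) (hR : 0 < R) (n : ℕ)
    (hw : StronglyMeasurable w) (hw2 : MemLp w 2 volume)
    (hsupp : ∀ k, w k ≠ 0 → 1 / R ≤ |k| ∧ |k| ≤ R) :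
    Integrable (pairingIntegrand α ν n w) := by
  have hm : Measurable fun p : ℝ × ℝ => (p.1 + p.2) ^ (2 * n + 1) / resonance α ν p.1 p.2 :=
    (by fun_prop : Measurable fun p : ℝ × ℝ => (p.1 + p.2) ^ (2 * n + 1)).div
      measurable_resonance
  have hi := integrable_tripleProduct hw hw2 fun k hk => (hsupp k hk).2
  refine (hi.norm.const_mul ((2 * R) ^ (2 * n) * bandConst α ν R)).mono'
    ((Complex.measurable_ofReal.comp hm).stronglyMeasurable.mul
      (stronglyMeasurable_tripleProduct hw)).aestronglyMeasurable
    (Eventually.of_forall fun ⟨a, b⟩ => ?_)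
  rw [pairingIntegrand, norm_mul, Complex.norm_real, Real.norm_eq_abs]
  by_cases ha : w a = 0
  · simp [tripleProduct, ha]
  by_cases hb : w b = 0
  · simp [tripleProduct, hb]
  have ha' := hsupp a ha
  have hb' := hsupp b hb
  gcongr
  rw [pow_succ, mul_div_assoc, abs_mul, abs_pow]
  have hk : |a + b| ≤ 2 * R := (abs_add_le a b).trans (by linarith)
  gcongr
  exact abs_div_resonance_le hα hν hR ha'.1 ha'.2 hb'.1 hb'.2

/-- Averaging over the rotations of the three frequencies symmetrizes the symbol. -/
lemma three_mul_integral_pairingIntegrand {n : ℕ} (hi : Integrable (pairingIntegrand α ν n w)) :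
    (3 : ℝ) • ∫ p, pairingIntegrand α ν n w p = trilinear α ν n w := by
  rw [← integral_sum_rotate hi, trilinear]
  congr 1
  funext ⟨a, b⟩
  have ho : Odd (2 * n + 1) := ⟨n, rfl⟩
  have e1 : -b - (-a - b) = a := by ring
  have e2 : b + (-a - b) = -a := by ring
  have e3 : -a - b + a = -b := by ring
  have r1 := resonance_rotate (α := α) (ν := ν) a b
  have r2 := resonance_rotate (α := α) (ν := ν) b (-a - b)
  have t1 := tripleProduct_rotate w a b
  have t2 := tripleProduct_rotate w b (-a - b)
  rw [e1] at r2 t2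
  simp only [Function.comp_apply, rotate, pairingIntegrand, e1, e2, e3, r1, r2, t1, t2, symSymbol,
    ho.neg_pow]
  push_cast
  ring

/-- The symmetrized form of the pairing of a real-valued band-limited function. -/
lemma rawPairing_eq (hα : 0 < α) (hν : 0 < ν) (hR : 0 < R) (n : ℕ) {v : L2C}
    (hv : hat v =ᵐ[volume] w) (hw : StronglyMeasurable w)
    (hsupp : ∀ k, w k ≠ 0 → 1 / R ≤ |k| ∧ |k| ≤ R)
    (hreal : ∀ᵐ k, starRingEnd ℂ (w k) = w (-k)) :
    rawPairing α κ lam μ ν n v =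
      (2 * Real.pi)⁻¹ * (lam * ν / (2 * (κ * ν + μ)) / 3) * (trilinear α ν n w).re := by
  have hw2 : MemLp w 2 volume := (memLp_hat v).ae_eq hv
  have hP2 : MemLp (pseudoConv α κ lam μ ν w) 2 volume :=
    memLp_pseudoConv hα hν hR hw hw2 hsupp
  have hP : hat (pseudoProduct α κ lam μ ν v v) =ᵐ[volume] pseudoConv α κ lam μ ν w := by
    rw [pseudoProduct_eq hv]
    exact hat_invHat hP2
  have h1 := hat_dx_sqrtOp_of_support (ν := ν) hα n hw2 hv fun k hk => (hsupp k hk).2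
  have h2 := hat_dx_sqrtOp_of_support (ν := ν) hα n hP2 hP (pseudoConv_support hsupp)
  have hi := integrable_pairingIntegrand hα hν hR n hw hw2 hsupp
  set C := lam * ν / (2 * (κ * ν + μ)) with hC
  have hshear : MeasurePreserving (fun p : ℝ × ℝ => (p.1 - p.2, p.2)) volume volume :=
    measurePreserving_sub_prod (volume : Measure ℝ) (volume : Measure ℝ)
  have hshear_emb : MeasurableEmbedding fun p : ℝ × ℝ => (p.1 - p.2, p.2) := by
    refine Continuous.measurableEmbedding (by fun_prop) fun p q h => ?_
    simp only [Prod.mk.injEq] at h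
    ext <;> linarith [h.1, h.2]
  have hi' : Integrable fun p : ℝ × ℝ => pairingIntegrand α ν n w (p.1 - p.2, p.2) :=
    (hshear.integrable_comp_emb hshear_emb).2 hi
  -- With `a = k - l` and `b = l`, the Hermitian symmetry turns `conj (w k)` into `w (-a - b)`.
  have key : ∫ k, starRingEnd ℂ (hat (dx n (sqrtOp α ν v)) k) *
      hat (dx n (sqrtOp α ν (pseudoProduct α κ lam μ ν v v))) k =
      (C : ℂ) * ∫ p, pairingIntegrand α ν n w p := by
    rw [← hshear.integral_comp hshear_emb]
    have hprod : ∫ p : ℝ × ℝ, pairingIntegrand α ν n w (p.1 - p.2, p.2) =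
        ∫ k : ℝ, ∫ l : ℝ, pairingIntegrand α ν n w (k - l, l) := integral_prod _ hi'
    rw [hprod, ← integral_const_mul]
    refine integral_congr_ae ?_
    filter_upwards [h1, h2, hreal] with k h1 h2 h3
    rw [h1, h2, map_mul, map_mul, h3, Complex.conj_ofReal, pseudoConv, ← integral_const_mul,
      ← integral_const_mul, ← integral_const_mul, ← integral_const_mul]
    congr 1
    funext l
    have e1 : -(k - l) - l = -k := by ring
    have hm := weight_mul_normalFormSymbol (α := α) hν κ lam μ (k - l) l
    rw [sub_add_cancel, ← hC] at hm
    have hm' : (weight α ν k : ℂ) * normalFormSymbol α κ lam μ ν (k - l) l =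
        (C : ℂ) * ((k : ℂ) / resonance α ν (k - l) l) := by exact_mod_cast hm
    have hs : ((Real.sqrt (weight α ν k) : ℝ) : ℂ) * ((Real.sqrt (weight α ν k) : ℝ) : ℂ)
        = weight α ν k := by
      rw [← Complex.ofReal_mul, Real.mul_self_sqrt (weight_pos hν k).le]
    have hIk : starRingEnd ℂ ((Complex.I * (k : ℂ)) ^ n) * (Complex.I * (k : ℂ)) ^ n
        = (k : ℂ) ^ (2 * n) := by
      rw [map_pow, ← mul_pow, pow_mul]
      congr 1
      rw [map_mul, Complex.conj_I, Complex.conj_ofReal]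
      linear_combination -(k : ℂ) ^ 2 * Complex.I_sq
    simp only [pairingIntegrand, tripleProduct, e1, sub_add_cancel]
    push_cast
    calc _ = (starRingEnd ℂ ((Complex.I * (k : ℂ)) ^ n) * (Complex.I * (k : ℂ)) ^ n) *
          (((Real.sqrt (weight α ν k) : ℝ) : ℂ) * ((Real.sqrt (weight α ν k) : ℝ) : ℂ)) *
          normalFormSymbol α κ lam μ ν (k - l) l * (w (k - l) * w l * w (-k)) := by ring
      _ = (k : ℂ) ^ (2 * n) * ((weight α ν k : ℂ) * normalFormSymbol α κ lam μ ν (k - l) l) *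
          (w (k - l) * w l * w (-k)) := by rw [hIk, hs]; ring
      _ = _ := by rw [hm']; ring
  have h3 := three_mul_integral_pairingIntegrand hi
  rw [rawPairing, ip, inner_eq_integral_hat, key, ← h3, Complex.smul_re, Complex.re_ofReal_mul,
    Complex.smul_re, smul_eq_mul, smul_eq_mul]
  ring

end band

/-! ### The principal value limit -/

/-- The restriction of `w` to the frequencies `1/R ≤ |k| ≤ R`. -/
def bandCut (R : ℝ) (w : ℝ → ℂ) : ℝ → ℂ := Set.indicator {k : ℝ | 1 / R ≤ |k| ∧ |k| ≤ R} w

lemma measurableSet_band (R : ℝ) : MeasurableSet {k : ℝ | 1 / R ≤ |k| ∧ |k| ≤ R} :=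
  (measurableSet_le (measurable_const (a := 1 / R)) measurable_id.abs).inter
    (measurableSet_le measurable_id.abs (measurable_const (a := R)))

lemma bandCut_support {R : ℝ} {w : ℝ → ℂ} (k : ℝ) (h : bandCut R w k ≠ 0) :
    1 / R ≤ |k| ∧ |k| ≤ R :=
  Set.mem_of_indicator_ne_zero (s := {k : ℝ | 1 / R ≤ |k| ∧ |k| ≤ R}) (f := w) h

lemma norm_bandCut_le (R : ℝ) (w : ℝ → ℂ) (k : ℝ) : ‖bandCut R w k‖ ≤ ‖w k‖ :=
  norm_indicator_le_norm_self _ _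

lemma eventually_bandCut_eq (w : ℝ → ℂ) {k : ℝ} (hk : k ≠ 0) :
    ∀ᶠ R in atTop, bandCut R w k = w k := by
  filter_upwards [eventually_ge_atTop |k|, eventually_ge_atTop (1 / |k|),
    eventually_gt_atTop 0] with R h1 h2 h3
  exact Set.indicator_of_mem (s := {k : ℝ | 1 / R ≤ |k| ∧ |k| ≤ R})
    ⟨(one_div_le h3 (abs_pos.2 hk)).2 h2, h1⟩ w

lemma hat_bandPart (R : ℝ) (u : L2C) : hat (bandPart R u) =ᵐ[volume] bandCut R (hat u) := by
  have e : (fun k => Set.indicator {k : ℝ | 1 / R ≤ |k| ∧ |k| ≤ R} (fun _ => (1 : ℂ)) k * hat u k)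
      = bandCut R (hat u) := by
    funext k
    unfold bandCut
    by_cases h : k ∈ {k : ℝ | 1 / R ≤ |k| ∧ |k| ≤ R}
    · rw [Set.indicator_of_mem h, Set.indicator_of_mem h, one_mul]
    · rw [Set.indicator_of_notMem h, Set.indicator_of_notMem h, zero_mul]
  have h : MemLp (bandCut R (hat u)) 2 volume := (memLp_hat u).indicator (measurableSet_band R)
  unfold bandPart
  rw [← e] at h ⊢
  exact hat_multiplier h

section limit

variable {α κ lam μ ν : ℝ}

/-- The symmetrized symbol vanishes when one of the three frequencies does, so that the truncation
to the band converges pointwise everywhere. -/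
lemma tendsto_symSymbol_mul_tripleProduct (n : ℕ) (w : ℝ → ℂ) (a b : ℝ) :
    Tendsto (fun R => (symSymbol α ν (2 * n + 1) a b : ℂ) * tripleProduct (bandCut R w) a b) atTop
      (𝓝 ((symSymbol α ν (2 * n + 1) a b : ℂ) * tripleProduct w a b)) := by
  have ho : Odd (2 * n + 1) := ⟨n, rfl⟩
  by_cases ha : a = 0
  · simp [symSymbol, ha]
  by_cases hb : b = 0
  · simp [symSymbol, hb]
  by_cases hc : -a - b = 0
  · have hb' : b = -a := by linarith
    simp [symSymbol, hb', ho.neg_pow]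
  refine tendsto_const_nhds.congr' ?_
  filter_upwards [eventually_bandCut_eq w ha, eventually_bandCut_eq w hb,
    eventually_bandCut_eq w hc] with R h1 h2 h3
  rw [tripleProduct, tripleProduct, h1, h2, h3]

lemma tendsto_trilinear_bandCut {n : ℕ} {w : ℝ → ℂ} (hw : StronglyMeasurable w)
    (hi : Integrable fun p : ℝ × ℝ =>
      (symSymbol α ν (2 * n + 1) p.1 p.2 : ℂ) * tripleProduct w p.1 p.2) :
    Tendsto (fun R => trilinear α ν n (bandCut R w)) atTop (𝓝 (trilinear α ν n w)) := by
  refine tendsto_integral_filter_of_dominated_convergence _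
    (Eventually.of_forall fun R => ?_) (Eventually.of_forall fun R =>
      Eventually.of_forall fun p => ?_) hi.norm
    (Eventually.of_forall fun p => tendsto_symSymbol_mul_tripleProduct n w p.1 p.2)
  · exact ((Complex.measurable_ofReal.comp (measurable_symSymbol _)).stronglyMeasurable.mul
      (stronglyMeasurable_tripleProduct (hw.indicator (measurableSet_band R)))).aestronglyMeasurable
  · rw [norm_mul, norm_mul]
    gcongr
    simp only [tripleProduct, norm_mul]
    gcongr <;> exact norm_bandCut_le R w _

/-- The factor between the pairing and the symmetrized trilinear form. -/
def pairingConst (κ lam μ ν : ℝ) : ℝ := (2 * Real.pi)⁻¹ * (lam * ν / (2 * (κ * ν + μ)) / 3)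

lemma rawPairing_bandPart_eq (hα : 0 < α) (hν : 0 < ν) {R : ℝ} (hR : 0 < R) (n : ℕ) (u : L2R) :
    rawPairing α κ lam μ ν n (bandPart R (complexify u)) =
      pairingConst κ lam μ ν * (trilinear α ν n (bandCut R (hat (complexify u)))).re := by
  refine rawPairing_eq hα hν hR n (hat_bandPart R _)
    ((stronglyMeasurable_hat _).indicator (measurableSet_band R)) bandCut_support ?_
  filter_upwards [conj_hat_complexify u] with k hk
  unfold bandCut
  by_cases h : k ∈ {k : ℝ | 1 / R ≤ |k| ∧ |k| ≤ R}
  · have h' : -k ∈ {k : ℝ | 1 / R ≤ |k| ∧ |k| ≤ R} := by simpa using h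
    rw [Set.indicator_of_mem h, Set.indicator_of_mem h', hk]
  · have h' : -k ∉ {k : ℝ | 1 / R ≤ |k| ∧ |k| ≤ R} := by simpa using h
    rw [Set.indicator_of_notMem h, Set.indicator_of_notMem h', map_zero]

lemma tendsto_rawPairing (hα : 0 < α) (hν : 0 < ν) {n : ℕ} {u : L2R}
    (hi : Integrable fun p : ℝ × ℝ => (symSymbol α ν (2 * n + 1) p.1 p.2 : ℂ) *
      tripleProduct (hat (complexify u)) p.1 p.2) :
    Tendsto (fun R : ℝ => rawPairing α κ lam μ ν n (bandPart R (complexify u))) atTop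
      (𝓝 (pairingConst κ lam μ ν * (trilinear α ν n (hat (complexify u))).re)) := by
  have h := tendsto_trilinear_bandCut (stronglyMeasurable_hat (complexify u)) hi
  have h2 := ((Complex.continuous_re.tendsto _).comp h).const_mul (pairingConst κ lam μ ν)
  refine h2.congr' ?_
  filter_upwards [eventually_gt_atTop 0] with R hR
  exact (rawPairing_bandPart_eq hα hν hR n u).symm

lemma pairing_eq (hα : 0 < α) (hν : 0 < ν) {n : ℕ} {u : L2R}
    (hi : Integrable fun p : ℝ × ℝ => (symSymbol α ν (2 * n + 1) p.1 p.2 : ℂ) *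
      tripleProduct (hat (complexify u)) p.1 p.2) :
    pairing α κ lam μ ν n (complexify u) =
      pairingConst κ lam μ ν * (trilinear α ν n (hat (complexify u))).re :=
  (tendsto_rawPairing hα hν hi).limUnder_eq

end limit

/-! ### The quadratic part of the energy -/

section quadratic

variable {α ν : ℝ} {N : ℕ}

/-- The density of the quadratic part of the energy. -/
def quadWeight (α ν : ℝ) (N : ℕ) (k : ℝ) : ℝ :=
  (∑ n ∈ Finset.Icc 1 N, k ^ (2 * n) * weight α ν k) + weight α ν k

lemma pow_mul_weight_le_sobolev (hα : 0 < α) (hν : 0 < ν) {n : ℕ} (hn : n ≤ N) (k : ℝ) :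
    k ^ (2 * n) * weight α ν k ≤ (1 + ν) * (1 + k ^ 2) ^ (N + α / 2) := by
  have h1 : k ^ (2 * n) ≤ (1 + k ^ 2) ^ N := by
    rw [pow_mul]
    calc (k ^ 2) ^ n ≤ (1 + k ^ 2) ^ n := by gcongr; linarith
      _ ≤ (1 + k ^ 2) ^ N := pow_le_pow_right₀ (by nlinarith) hn
  have h2 := weight_le hα hν k
  have h3 := (weight_pos (α := α) hν k).le
  rw [Real.rpow_add (by positivity), Real.rpow_natCast]
  calc k ^ (2 * n) * weight α ν k ≤ (1 + k ^ 2) ^ N * ((1 + ν) * (1 + k ^ 2) ^ (α / 2)) := by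
        gcongr
    _ = _ := by ring

lemma quadWeight_le (hα : 0 < α) (hν : 0 < ν) (k : ℝ) :
    quadWeight α ν N k ≤ (N + 1) * (1 + ν) * (1 + k ^ 2) ^ (N + α / 2) := by
  have h1 : ∑ n ∈ Finset.Icc 1 N, k ^ (2 * n) * weight α ν k ≤
      ∑ n ∈ Finset.Icc 1 N, (1 + ν) * (1 + k ^ 2) ^ (N + α / 2) :=
    Finset.sum_le_sum fun n hn => pow_mul_weight_le_sobolev hα hν (Finset.mem_Icc.1 hn).2 k
  have h2 := pow_mul_weight_le_sobolev (α := α) hα hν (Nat.zero_le N) k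
  rw [Finset.sum_const, Nat.card_Icc, Nat.add_sub_cancel, nsmul_eq_mul] at h1
  rw [mul_zero, pow_zero, one_mul] at h2
  unfold quadWeight
  linarith

lemma le_quadWeight (hα : 0 < α) (hα1 : α < 1) (hν : 0 < ν) (hN : 1 ≤ N) (k : ℝ) :
    (1 + k ^ 2) ^ (N + α / 2) ≤ 2 ^ (N - 1) * (1 + 1 / ν) * quadWeight α ν N k := by
  have hw := weight_pos (α := α) hν k
  have h1 : (1 + k ^ 2) ^ N ≤ 2 ^ (N - 1) * (1 + k ^ (2 * N)) := by
    have h := add_pow_le zero_le_one (sq_nonneg k) N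
    rwa [one_pow, ← pow_mul] at h
  have h2 : (1 + k ^ 2) ^ (α / 2) ≤ (1 + 1 / ν) * weight α ν k := by
    have h := Real.rpow_add_le_add_rpow zero_le_one (sq_nonneg k) (p := α / 2) (by positivity)
      (by linarith)
    have e : (k ^ 2) ^ (α / 2) = |k| ^ α := by
      rw [← sq_abs, ← Real.rpow_natCast_mul (abs_nonneg k)]
      congr 1
      push_cast
      ring
    rw [Real.one_rpow, e] at h
    have e2 : (1 + 1 / ν) * weight α ν k = 1 + |k| ^ α + 1 / ν + ν * |k| ^ α := by
      unfold weight
      field_simp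
      ring
    rw [e2]
    have : 0 ≤ 1 / ν + ν * |k| ^ α := by positivity
    linarith
  have h3 : (1 + k ^ (2 * N)) * weight α ν k ≤ quadWeight α ν N k := by
    have h := Finset.single_le_sum (f := fun n => k ^ (2 * n) * weight α ν k)
      (fun n _ => mul_nonneg (by rw [pow_mul]; positivity) hw.le)
      (Finset.mem_Icc.2 ⟨hN, le_refl N⟩)
    unfold quadWeight
    linarith
  rw [Real.rpow_add (by positivity), Real.rpow_natCast]
  calc (1 + k ^ 2) ^ N * (1 + k ^ 2) ^ (α / 2)
      ≤ 2 ^ (N - 1) * (1 + k ^ (2 * N)) * ((1 + 1 / ν) * weight α ν k) := by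
        have : 0 ≤ k ^ (2 * N) := by rw [pow_mul]; positivity
        gcongr
    _ = 2 ^ (N - 1) * (1 + 1 / ν) * ((1 + k ^ (2 * N)) * weight α ν k) := by ring
    _ ≤ _ := by gcongr

lemma norm_symbol_mul_sq (hν : 0 < ν) (n : ℕ) (k : ℝ) (z : ℂ) :
    ‖(Complex.I * (k : ℂ)) ^ n * (((Real.sqrt (weight α ν k) : ℝ) : ℂ) * z)‖ ^ 2 =
      k ^ (2 * n) * weight α ν k * ‖z‖ ^ 2 := by
  rw [norm_mul, norm_mul, norm_pow, norm_mul, Complex.norm_I, Complex.norm_real, Complex.norm_real,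
    one_mul, mul_pow, mul_pow, ← pow_mul, mul_comm n 2, pow_mul, Real.norm_eq_abs, sq_abs,
    Real.norm_eq_abs, sq_abs, Real.sq_sqrt (weight_pos hν k).le, pow_mul, mul_assoc]

lemma integrable_pow_mul_weight (hα : 0 < α) (hν : 0 < ν) {n : ℕ} (hn : n ≤ N) {w : ℝ → ℂ}
    (hw : StronglyMeasurable w)
    (hi : Integrable fun k : ℝ => (1 + k ^ 2) ^ (N + α / 2) * ‖w k‖ ^ 2) :
    Integrable fun k : ℝ => k ^ (2 * n) * weight α ν k * ‖w k‖ ^ 2 := by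
  have hm : Measurable fun k : ℝ => k ^ (2 * n) * weight α ν k :=
    (by fun_prop : Measurable fun k : ℝ => k ^ (2 * n)).mul measurable_weight
  refine (hi.const_mul (1 + ν)).mono' (hm.stronglyMeasurable.mul
    (hw.norm.pow 2)).aestronglyMeasurable (Eventually.of_forall fun k => ?_)
  have h1 := (weight_pos (α := α) hν k).le
  have h2 : 0 ≤ k ^ (2 * n) := by rw [pow_mul]; positivity
  rw [Real.norm_eq_abs, abs_of_nonneg (by positivity), ← mul_assoc]
  exact mul_le_mul_of_nonneg_right (pow_mul_weight_le_sobolev hα hν hn k) (sq_nonneg _)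

lemma memLp_symbol_mul (hα : 0 < α) (hν : 0 < ν) {n : ℕ} (hn : n ≤ N) {w : ℝ → ℂ}
    (hw : StronglyMeasurable w)
    (hi : Integrable fun k : ℝ => (1 + k ^ 2) ^ (N + α / 2) * ‖w k‖ ^ 2) :
    MemLp (fun k : ℝ => (Complex.I * (k : ℂ)) ^ n *
      (((Real.sqrt (weight α ν k) : ℝ) : ℂ) * w k)) 2 volume := by
  have hc : Continuous fun k : ℝ => ((Real.sqrt (weight α ν k) : ℝ) : ℂ) :=
    Complex.continuous_ofReal.comp (continuous_weight hα).sqrt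
  have hc' : Continuous fun k : ℝ => (Complex.I * (k : ℂ)) ^ n := by fun_prop
  have hm : StronglyMeasurable fun k : ℝ => (Complex.I * (k : ℂ)) ^ n *
      (((Real.sqrt (weight α ν k) : ℝ) : ℂ) * w k) :=
    hc'.stronglyMeasurable.mul (hc.stronglyMeasurable.mul hw)
  rw [memLp_two_iff_integrable_sq_norm hm.aestronglyMeasurable]
  simp only [norm_symbol_mul_sq hν]
  exact integrable_pow_mul_weight hα hν hn hw hi

lemma norm_sqrtOp_sq (hα : 0 < α) (hν : 0 < ν) {u : L2C}
    (hi : Integrable fun k : ℝ => (1 + k ^ 2) ^ (N + α / 2) * ‖hat u k‖ ^ 2) :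
    ‖sqrtOp α ν u‖ ^ 2 = (2 * Real.pi)⁻¹ * ∫ k, weight α ν k * ‖hat u k‖ ^ 2 := by
  have h0 := memLp_symbol_mul hα hν (Nat.zero_le N) (stronglyMeasurable_hat u) hi
  simp only [pow_zero, one_mul] at h0
  rw [norm_sq_eq_integral_hat]
  congr 1
  refine integral_congr_ae ?_
  filter_upwards [hat_sqrtOp h0] with k hk
  have h := norm_symbol_mul_sq (α := α) hν 0 k (hat u k)
  simp only [pow_zero, one_mul, mul_zero] at h
  rw [hk, h]

lemma norm_dx_sqrtOp_sq (hα : 0 < α) (hν : 0 < ν) {n : ℕ} (hn : n ≤ N) {u : L2C}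
    (hi : Integrable fun k : ℝ => (1 + k ^ 2) ^ (N + α / 2) * ‖hat u k‖ ^ 2) :
    ‖dx n (sqrtOp α ν u)‖ ^ 2 =
      (2 * Real.pi)⁻¹ * ∫ k, k ^ (2 * n) * weight α ν k * ‖hat u k‖ ^ 2 := by
  have h0 := memLp_symbol_mul hα hν (Nat.zero_le N) (stronglyMeasurable_hat u) hi
  simp only [pow_zero, one_mul] at h0
  rw [norm_sq_eq_integral_hat]
  congr 1
  refine integral_congr_ae ?_
  filter_upwards [hat_dx_sqrtOp h0 (memLp_symbol_mul hα hν hn (stronglyMeasurable_hat u) hi)]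
    with k hk
  rw [hk, norm_symbol_mul_sq hν]

/-- The quadratic part of the energy is equivalent to the square of the `H^{N+α/2}` norm. -/
lemma quadratic_bounds (hα : 0 < α) (hα1 : α < 1) (hν : 0 < ν) (hN : 1 ≤ N) {u : L2C}
    (hi : Integrable fun k : ℝ => (1 + k ^ 2) ^ (N + α / 2) * ‖hat u k‖ ^ 2) :
    (2 ^ (N - 1) * (1 + 1 / ν))⁻¹ * sobolevNorm (N + α / 2) u ^ 2 ≤
        (∑ n ∈ Finset.Icc 1 N, ‖dx n (sqrtOp α ν u)‖ ^ 2) + ‖sqrtOp α ν u‖ ^ 2 ∧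
      (∑ n ∈ Finset.Icc 1 N, ‖dx n (sqrtOp α ν u)‖ ^ 2) + ‖sqrtOp α ν u‖ ^ 2 ≤
        (N + 1) * (1 + ν) * sobolevNorm (N + α / 2) u ^ 2 := by
  have hw := stronglyMeasurable_hat u
  have hint : ∀ n ∈ Finset.Icc 1 N,
      Integrable fun k : ℝ => k ^ (2 * n) * weight α ν k * ‖hat u k‖ ^ 2 := fun n hn =>
    integrable_pow_mul_weight hα hν (Finset.mem_Icc.1 hn).2 hw hi
  have hint0 : Integrable fun k : ℝ => weight α ν k * ‖hat u k‖ ^ 2 := by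
    have h := integrable_pow_mul_weight hα hν (Nat.zero_le N) hw hi
    simpa only [mul_zero, pow_zero, one_mul] using h
  have hq : ∀ k, quadWeight α ν N k * ‖hat u k‖ ^ 2 =
      (∑ n ∈ Finset.Icc 1 N, k ^ (2 * n) * weight α ν k * ‖hat u k‖ ^ 2)
        + weight α ν k * ‖hat u k‖ ^ 2 := fun k => by
    rw [quadWeight, add_mul, Finset.sum_mul]
  have hqi : Integrable fun k => quadWeight α ν N k * ‖hat u k‖ ^ 2 := by
    simp only [hq]
    exact (integrable_finsetSum _ hint).add hint0
  have he : (∑ n ∈ Finset.Icc 1 N, ‖dx n (sqrtOp α ν u)‖ ^ 2) + ‖sqrtOp α ν u‖ ^ 2 =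
      (2 * Real.pi)⁻¹ * ∫ k, quadWeight α ν N k * ‖hat u k‖ ^ 2 := by
    simp only [hq]
    rw [integral_add (integrable_finsetSum _ hint) hint0, integral_finsetSum _ hint, mul_add,
      Finset.mul_sum, norm_sqrtOp_sq hα hν hi]
    congr 1
    exact Finset.sum_congr rfl fun n hn => norm_dx_sqrtOp_sq hα hν (Finset.mem_Icc.1 hn).2 hi
  rw [he, sobolevNorm_sq]
  constructor
  · rw [inv_mul_le_iff₀ (by positivity), mul_left_comm,
      ← integral_const_mul (2 ^ (N - 1) * (1 + 1 / ν))]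
    refine mul_le_mul_of_nonneg_left ?_ (by positivity)
    refine integral_mono hi (hqi.const_mul _) fun k => ?_
    simp only
    rw [← mul_assoc]
    gcongr
    exact le_quadWeight hα hα1 hν hN k
  · rw [mul_left_comm, ← integral_const_mul ((N + 1) * (1 + ν))]
    refine mul_le_mul_of_nonneg_left ?_ (by positivity)
    refine integral_mono hqi (hi.const_mul _) fun k => ?_
    simp only
    rw [← mul_assoc]
    gcongr
    exact quadWeight_le hα hν k

end quadratic

/-! ### The energy estimate -/

section energy

variable {α κ lam μ ν : ℝ} {N : ℕ}

lemma integrable_trilinear_of_memH (hα : 0 < α) (hα1 : α < 1) (hν : 0 < ν) {n : ℕ} (hn : 1 ≤ n)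
    (hnN : n ≤ N) {u : L2C} (hu : MemH (N + α / 2) u) :
    Integrable (fun p : ℝ × ℝ => (symSymbol α ν (2 * n + 1) p.1 p.2 : ℂ) *
      tripleProduct (hat u) p.1 p.2) ∧
    ‖trilinear α ν n (hat u)‖ ≤ trilinearConst α ν (N + α / 2) n * (2 * Real.pi) ^ (3 / 2 : ℝ) *
      sobolevNorm (N + α / 2) u ^ 3 := by
  have h1 : (1 : ℝ) ≤ n := by exact_mod_cast hn
  have h2 : (n : ℝ) ≤ N := by exact_mod_cast hnN
  obtain ⟨h3, h4⟩ := integrable_symSymbol_mul_tripleProduct (s := N + α / 2) hα hα1 hν hn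
    (by linarith) (by linarith) (stronglyMeasurable_hat u) (hu.integrable (by positivity))
  refine ⟨h3, h4.trans_eq ?_⟩
  have hQ : ∫ k : ℝ, (1 + k ^ 2) ^ (N + α / 2) * ‖hat u k‖ ^ 2 =
      2 * Real.pi * sobolevNorm (N + α / 2) u ^ 2 := by
    rw [sobolevNorm_sq, mul_inv_cancel_left₀ (by positivity)]
  have hX : 0 ≤ sobolevNorm (N + α / 2) u := Real.sqrt_nonneg _
  have e1 : (sobolevNorm (N + α / 2) u ^ 2) ^ (1 / 2 : ℝ) = sobolevNorm (N + α / 2) u := by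
    rw [← Real.sqrt_eq_rpow, Real.sqrt_sq hX]
  have e2 : (2 * Real.pi) ^ (3 / 2 : ℝ) = (2 * Real.pi) ^ (1 / 2 : ℝ) * (2 * Real.pi) := by
    rw [← Real.rpow_add_one (by positivity)]
    norm_num
  rw [hQ, Real.mul_rpow (by positivity) (by positivity), e1, e2]
  ring

/-- The cubic part of the energy is bounded by this multiple of the cube of the norm. -/
def cubicConst (α κ lam μ ν : ℝ) (N : ℕ) : ℝ :=
  ∑ n ∈ Finset.Icc 1 N, 2 * (|pairingConst κ lam μ ν| *
    (trilinearConst α ν (N + α / 2) n * (2 * Real.pi) ^ (3 / 2 : ℝ)))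

lemma cubicConst_nonneg (hα : 0 < α) (hν : 0 < ν) : 0 ≤ cubicConst α κ lam μ ν N := by
  refine Finset.sum_nonneg fun n _ => ?_
  have h1 := symConst_pos hα hν n
  have h2 := embeddingConst_nonneg (α := α) (s := N + α / 2) hν
  have h3 : 0 ≤ trilinearConst α ν (N + α / 2) n := by
    unfold trilinearConst
    positivity
  positivity

lemma abs_sum_pairing_le (hα : 0 < α) (hα1 : α < 1) (hν : 0 < ν) {u : L2R}
    (hu : MemH (N + α / 2) (complexify u)) :
    |∑ n ∈ Finset.Icc 1 N, 2 * pairing α κ lam μ ν n (complexify u)| ≤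
      cubicConst α κ lam μ ν N * sobolevNorm (N + α / 2) (complexify u) ^ 3 := by
  rw [cubicConst, Finset.sum_mul]
  refine (Finset.abs_sum_le_sum_abs _ _).trans (Finset.sum_le_sum fun n hn => ?_)
  obtain ⟨h1, h2⟩ := Finset.mem_Icc.1 hn
  obtain ⟨h3, h4⟩ := integrable_trilinear_of_memH hα hα1 hν h1 h2 hu
  rw [pairing_eq hα hν h3, abs_mul, abs_mul, abs_two, mul_assoc, mul_assoc]
  gcongr
  exact (Complex.abs_re_le_norm _).trans h4

end energy

end

end KdVBBM

open KdVBBM in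
theorem mainTheorem2 (α κ lam μ ν : ℝ) (hα0 : 0 < α) (hα1 : α < 1) (hlam : 0 < lam) (hν : 0 < ν)
    (hκμ : κ * ν + μ ≠ 0) (N : ℕ) (hN : 1 ≤ N) :
    (∀ u : L2R, MemH (N + α / 2) (complexify u) →
      ∀ n : ℕ, 1 ≤ n → n ≤ N →
        Filter.Tendsto (fun R : ℝ => rawPairing α κ lam μ ν n (bandPart R (complexify u)))
          Filter.atTop (nhds (pairing α κ lam μ ν n (complexify u)))) ∧
    ∃ ε c C : ℝ, 0 < ε ∧ 0 < c ∧ 0 < C ∧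
      ∀ u : L2R, MemH (N + α / 2) (complexify u) →
        sobolevNorm (N + α / 2) (complexify u) < ε →
          c * sobolevNorm (N + α / 2) (complexify u) ^ 2
              ≤ modifiedEnergy α κ lam μ ν N (complexify u) ∧
          modifiedEnergy α κ lam μ ν N (complexify u)
              ≤ C * sobolevNorm (N + α / 2) (complexify u) ^ 2 := by
  refine ⟨fun u hu n hn hnN => ?_, ?_⟩
  · have hi := (integrable_trilinear_of_memH hα0 hα1 hν hn hnN hu).1
    rw [pairing_eq hα0 hν hi]
    exact tendsto_rawPairing hα0 hν hi
  set c₀ : ℝ := (2 ^ (N - 1) * (1 + 1 / ν))⁻¹ with hc₀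
  -- For `‖u‖ < c₀ / (2 (D + 1))` the cubic part is at most half of the quadratic lower bound.
  set D := cubicConst α κ lam μ ν N
  have hD : 0 ≤ D := cubicConst_nonneg hα0 hν
  have hc₀' : 0 < c₀ := by positivity
  refine ⟨c₀ / 2 / (D + 1), c₀ / 2, (N + 1) * (1 + ν) + c₀ / 2, by positivity, by positivity,
    by positivity, fun u hu hsmall => ?_⟩
  obtain ⟨h1, h2⟩ := quadratic_bounds hα0 hα1 hν hN (hu.integrable (by positivity))
  have h3 := abs_sum_pairing_le (κ := κ) (lam := lam) (μ := μ) hα0 hα1 hν hu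
  set X := sobolevNorm (N + α / 2) (complexify u)
  have hX : 0 ≤ X := Real.sqrt_nonneg _
  have h4 : D * X ≤ c₀ / 2 := by
    rw [lt_div_iff₀ (by positivity)] at hsmall
    linarith
  have h5 : D * X ^ 3 ≤ c₀ / 2 * X ^ 2 := by
    have h := mul_le_mul_of_nonneg_right h4 (sq_nonneg X)
    linarith
  have h6 := abs_le.1 (h3.trans h5)
  have he : modifiedEnergy α κ lam μ ν N (complexify u) =
      ((∑ n ∈ Finset.Icc 1 N, ‖dx n (sqrtOp α ν (complexify u))‖ ^ 2)
        + ‖sqrtOp α ν (complexify u)‖ ^ 2)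
        + ∑ n ∈ Finset.Icc 1 N, 2 * pairing α κ lam μ ν n (complexify u) := by
    simp only [modifiedEnergy, partialEnergy, Finset.sum_add_distrib]
    ring
  rw [he]
  constructor <;> linarith [h6.1, h6.2]
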